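/- Let $\mathbb{S}^2\subset\mathbb{R}^3$ be the unit sphere with its round metric $g_0$, its Laplace–Beltrami operator $\Delta_{g_0}$ and its Riemannian volume $\operatorname{Vol}_{g_0}$ (of total mass $4\pi$). For an integer $l\ge 0$, let $E_l=\operatorname{Ker}(\Delta_{g_0}+l(l+1))$ be the space of complex-valued spherical harmonics of degree $l$; it has dimension $2l+1$. Let $\mathcal{B}_l$ be the set of orthonormal bases $b=(e_{-l},\ldots,e_l)$ of $E_l$ for the inner product of $L^2(\mathbb{S}^2,\operatorname{Vol}_{g_0})$. It is non-empty, and the choice of a reference basis $(e^0_j)_j$ identifies it with the unitary group $U(2l+1)$, a matrix $U$ corresponding to the basis with members $e_m=\sum_j U_{jm}e^0_j$. Let $\mathbb{P}_l$ be the probability measure on $\mathcal{B}_l$ that corresponds to the Haar probability measure on $U(2l+1)$ (it does not depend on the reference basis). Theorem. Let $a:\mathbb{S}^2\to\mathbb{C}$ be a continuous function. Then there exist constants $C_a>0$ and $c_a>0$, depending only on $a$, such that, for every integer $l\ge 0$, $$\mathbb{P}_l\left(\left\{b=(e_{-l},\ldots,e_l)\in\mathcal{B}_l:\ \sup_{-l\le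 m\le l}\left|\int_{\mathbb{S}^2}a|e_m|^2\,d\operatorname{Vol}_{g_0}-\frac{1}{\operatorname{Vol}_{g_0}(\mathbb{S}^2)}\int_{\mathbb{S}^2}a\,d\operatorname{Vol}_{g_0}\right|\ge l^{-\frac18}\right\}\right)\le C_a\,e^{-c_a\sqrt{l}}.$$ -/

import Mathlib

open MeasureTheory
open scoped ContDiff

/-- The unit sphere `S²` of Euclidean three-space, with its subspace topology. -/
abbrev S2 : Type := Metric.sphere (0 : EuclideanSpace ℝ (Fin 3)) 1

/-- The Riemannian volume (surface measure, of total mass `4π`) of the round sphere `S²`. -/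
noncomputable abbrev volS2 : Measure S2 :=
  (volume : Measure (EuclideanSpace ℝ (Fin 3))).toSphere

/-- The extension of a function on `S²` that is constant along rays, `x ↦ f (x / ‖x‖)`.
The value at the origin plays no role. -/
noncomputable def radialExtension (f : S2 → ℂ) (x : EuclideanSpace ℝ (Fin 3)) : ℂ :=
  if hx : x = 0 then 0
  else f ⟨‖x‖⁻¹ • x, by
    rw [mem_sphere_zero_iff_norm]
    exact norm_smul_inv_norm (𝕜 := ℝ) hx⟩

/-- `f` is a smooth function on the sphere: its extension constant along rays is smooth away from
the origin. -/
def IsSmoothS2 (f : S2 → ℂ) : Prop :=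
  ContDiffOn ℝ ∞ (radialExtension f) {0}ᶜ

/-- The Laplace–Beltrami operator of the round metric on `S²` applied to a smooth function `f`:
the restriction to `S²` of the Euclidean Laplacian of the extension of `f` constant along rays. -/
noncomputable def laplaceS2 (f : S2 → ℂ) (x : S2) : ℂ :=
  Laplacian.laplacian (radialExtension f) (x : EuclideanSpace ℝ (Fin 3))

theorem radialExtension_add (f g : S2 → ℂ) :
    radialExtension (f + g) = radialExtension f + radialExtension g := by
  funext x
  by_cases hx : x = 0 <;> simp [radialExtension, hx]

theorem radialExtension_smul (c : ℂ) (f : S2 → ℂ) :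
    radialExtension (c • f) = c • radialExtension f := by
  funext x
  by_cases hx : x = 0 <;> simp [radialExtension, hx]

theorem IsSmoothS2.contDiffAt {f : S2 → ℂ} (hf : IsSmoothS2 f) (x : S2) :
    ContDiffAt ℝ 2 (radialExtension f) (x : EuclideanSpace ℝ (Fin 3)) := by
  have hx : (x : EuclideanSpace ℝ (Fin 3)) ∈ ({0}ᶜ : Set (EuclideanSpace ℝ (Fin 3))) := by
    have h := x.2
    rw [mem_sphere_zero_iff_norm] at h
    intro h0
    rw [Set.mem_singleton_iff] at h0
    simp [h0] at h
  exact (ContDiffOn.contDiffAt hf (isOpen_compl_singleton.mem_nhds hx)).of_le (WithTop.coe_le_coe.2 le_top)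

/-- The eigenspace `E_l = Ker (Δ + l (l + 1))` of the Laplace–Beltrami operator on `S²`, i.e. the
space of complex-valued spherical harmonics of degree `l`. -/
noncomputable def sphericalHarmonics (l : ℕ) : Submodule ℂ C(S2, ℂ) where
  carrier := {f | IsSmoothS2 f ∧ ∀ x : S2, laplaceS2 f x + (l : ℂ) * ((l : ℂ) + 1) * f x = 0}
  zero_mem' := by
    have h0 : radialExtension (⇑(0 : C(S2, ℂ))) = fun _ => 0 := by
      funext x
      by_cases hx : x = 0 <;> simp [radialExtension, hx]
    refine ⟨?_, fun x => ?_⟩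
    · rw [IsSmoothS2, h0]
      exact contDiffOn_const
    · rw [laplaceS2, h0]
      simp
  add_mem' := by
    rintro f g ⟨hf, hf'⟩ ⟨hg, hg'⟩
    refine ⟨?_, fun x => ?_⟩
    · rw [IsSmoothS2, ContinuousMap.coe_add, radialExtension_add]
      exact ContDiffOn.add hf hg
    · have h := (hf.contDiffAt x).laplacian_add (hg.contDiffAt x)
      have h1 := hf' x
      have h2 := hg' x
      rw [laplaceS2] at h1 h2
      rw [laplaceS2, ContinuousMap.coe_add, radialExtension_add, h, Pi.add_apply]
      linear_combination h1 + h2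
  smul_mem' := by
    rintro c f ⟨hf, hf'⟩
    refine ⟨?_, fun x => ?_⟩
    · rw [IsSmoothS2, ContinuousMap.coe_smul, radialExtension_smul]
      exact ContDiffOn.const_smul c hf
    · have h := InnerProductSpace.laplacian_smul c (hf.contDiffAt x)
      have h1 := hf' x
      rw [laplaceS2] at h1
      rw [laplaceS2, ContinuousMap.coe_smul, radialExtension_smul, h, Pi.smul_apply]
      simp only [smul_eq_mul]
      linear_combination c * h1

/-- `e` is an orthonormal basis of `E_l`, indexed by `2 l + 1` labels, for the inner product of
`L²(S²)`. -/
def IsHarmonicONB (l : ℕ) (e : Fin (2 * l + 1) → C(S2, ℂ)) : Prop :=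
  Submodule.span ℂ (Set.range e) = sphericalHarmonics l ∧
    ∀ m n, ∫ x, starRingEnd ℂ (e m x) * e n x ∂volS2 = if m = n then 1 else 0

/-- The set `B_l` of orthonormal bases of `E_l`. -/
def HarmonicONB (l : ℕ) : Type := {e : Fin (2 * l + 1) → C(S2, ℂ) // IsHarmonicONB l e}

/-- `B_l` carries the topology of uniform convergence of the `2 l + 1` basis functions. -/
noncomputable instance (l : ℕ) : TopologicalSpace (HarmonicONB l) :=
  inferInstanceAs (TopologicalSpace {e : Fin (2 * l + 1) → C(S2, ℂ) // IsHarmonicONB l e})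

noncomputable instance (l : ℕ) : MeasurableSpace (HarmonicONB l) := borel _

instance (l : ℕ) : BorelSpace (HarmonicONB l) := ⟨rfl⟩

/-- The unitary group `U(2 l + 1)`, with its usual topology and Borel sets. -/
abbrev UnitaryS2 (l : ℕ) : Type := Matrix.unitaryGroup (Fin (2 * l + 1)) ℂ

noncomputable instance (l : ℕ) : MeasurableSpace (UnitaryS2 l) := borel _

instance (l : ℕ) : BorelSpace (UnitaryS2 l) := ⟨rfl⟩

instance (l : ℕ) : CompactSpace (UnitaryS2 l) := by
  refine (isCompact_iff_compactSpace (s := SetLike.coe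
    (unitary (Matrix (Fin (2 * l + 1)) (Fin (2 * l + 1)) ℂ)))).mp ?_
  have hK : IsCompact (Set.pi Set.univ fun _ : Fin (2 * l + 1) =>
      Set.pi Set.univ fun _ : Fin (2 * l + 1) => Metric.closedBall (0 : ℂ) 1) :=
    isCompact_univ_pi fun _ => isCompact_univ_pi fun _ => isCompact_closedBall _ _
  refine hK.of_isClosed_subset
    (isClosed_unitary (R := Matrix (Fin (2 * l + 1)) (Fin (2 * l + 1)) ℂ)) ?_
  intro U hU i _ j _
  rw [mem_closedBall_zero_iff]
  exact entry_norm_bound_of_unitary hU i j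

/-- The Haar probability measure on `U(2 l + 1)`. -/
noncomputable def haarUnitary (l : ℕ) : Measure (UnitaryS2 l) := Measure.haarMeasure ⊤

instance (l : ℕ) : IsProbabilityMeasure (haarUnitary l) :=
  ⟨by simpa [haarUnitary] using
    Measure.haarMeasure_self (K₀ := (⊤ : TopologicalSpace.PositiveCompacts (UnitaryS2 l)))⟩

/-- The family `e U`, whose `m`-th member is `∑ j, U j m • e j`. -/
noncomputable def rotateFamily {l : ℕ} (e : Fin (2 * l + 1) → C(S2, ℂ)) (U : UnitaryS2 l) :
    Fin (2 * l + 1) → C(S2, ℂ) :=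
  fun m => ∑ j, (U : Matrix (Fin (2 * l + 1)) (Fin (2 * l + 1)) ℂ) j m • e j

theorem rotateFamily_mul {l : ℕ} (e : Fin (2 * l + 1) → C(S2, ℂ)) (U V : UnitaryS2 l) :
    rotateFamily e (U * V) = rotateFamily (rotateFamily e U) V := by
  funext m
  ext x
  simp only [rotateFamily, Matrix.UnitaryGroup.mul_val, Matrix.mul_apply,
    ContinuousMap.sum_apply, ContinuousMap.smul_apply, smul_eq_mul, Finset.sum_mul,
    Finset.mul_sum]
  rw [Finset.sum_comm]
  refine Finset.sum_congr rfl fun i _ => Finset.sum_congr rfl fun j _ => ?_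
  ring

theorem rotateFamily_one {l : ℕ} (e : Fin (2 * l + 1) → C(S2, ℂ)) :
    rotateFamily e (1 : UnitaryS2 l) = e := by
  funext m
  ext x
  simp only [rotateFamily, Matrix.UnitaryGroup.one_val, Matrix.one_apply,
    ContinuousMap.sum_apply, ContinuousMap.smul_apply, smul_eq_mul]
  simp

theorem span_rotateFamily_le {l : ℕ} (e : Fin (2 * l + 1) → C(S2, ℂ)) (U : UnitaryS2 l) :
    Submodule.span ℂ (Set.range (rotateFamily e U)) ≤ Submodule.span ℂ (Set.range e) := by
  rw [Submodule.span_le]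
  rintro _ ⟨m, rfl⟩
  exact Submodule.sum_mem _ fun j _ =>
    Submodule.smul_mem _ _ (Submodule.subset_span (Set.mem_range_self j))

theorem integrable_conj_mul (f g : C(S2, ℂ)) :
    Integrable (fun x => starRingEnd ℂ (f x) * g x) volS2 :=
  Continuous.integrable_of_hasCompactSupport (by fun_prop)
    (HasCompactSupport.of_compactSpace _)

theorem IsHarmonicONB.rotate {l : ℕ} {e : Fin (2 * l + 1) → C(S2, ℂ)} (he : IsHarmonicONB l e)
    (U : UnitaryS2 l) : IsHarmonicONB l (rotateFamily e U) := by
  refine ⟨?_, fun m n => ?_⟩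
  · rw [← he.1]
    refine le_antisymm (span_rotateFamily_le e U) ?_
    have h := span_rotateFamily_le (rotateFamily e U) U⁻¹
    rwa [← rotateFamily_mul, mul_inv_cancel, rotateFamily_one] at h
  · set A : Matrix (Fin (2 * l + 1)) (Fin (2 * l + 1)) ℂ := U.1 with hA
    have h1 : ∀ x, starRingEnd ℂ (rotateFamily e U m x) * rotateFamily e U n x =
        ∑ i, ∑ j, (starRingEnd ℂ (A i m) * A j n) * (starRingEnd ℂ (e i x) * e j x) := by
      intro x
      simp only [rotateFamily, ContinuousMap.sum_apply, ContinuousMap.smul_apply, smul_eq_mul,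
        map_sum, map_mul, Finset.sum_mul_sum, ← hA]
      refine Finset.sum_congr rfl fun i _ => Finset.sum_congr rfl fun j _ => ?_
      ring
    simp only [h1]
    rw [integral_finsetSum _ fun i _ => integrable_finsetSum _ fun j _ =>
      (integrable_conj_mul (e i) (e j)).const_mul _]
    have h2 : ∀ i, ∫ x, ∑ j, (starRingEnd ℂ (A i m) * A j n) *
        (starRingEnd ℂ (e i x) * e j x) ∂volS2 = starRingEnd ℂ (A i m) * A i n := by
      intro i
      rw [integral_finsetSum _ fun j _ => (integrable_conj_mul (e i) (e j)).const_mul _]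
      simp only [integral_const_mul, he.2]
      simp
    simp only [h2]
    have h3 : (star A * A) m n = (1 : Matrix (Fin (2 * l + 1)) (Fin (2 * l + 1)) ℂ) m n := by
      rw [Matrix.mem_unitaryGroup_iff'.1 U.2]
    rw [Matrix.mul_apply, Matrix.one_apply] at h3
    simpa [Matrix.star_apply] using h3

/-- The identification of `U(2 l + 1)` with `B_l` given by a reference basis `b₀`: the matrix `U`
corresponds to the basis whose `m`-th element is `∑ j, U j m • b₀ j`. -/
noncomputable def HarmonicONB.rotate {l : ℕ} (b₀ : HarmonicONB l) (U : UnitaryS2 l) : HarmonicONB l :=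
  ⟨rotateFamily b₀.1 U, b₀.2.rotate U⟩

theorem HarmonicONB.continuous_rotate {l : ℕ} (b₀ : HarmonicONB l) : Continuous b₀.rotate := by
  refine Continuous.subtype_mk ?_ _
  refine continuous_pi fun m => continuous_finsetSum _ fun j _ => ?_
  have h : Continuous fun U : UnitaryS2 l => U.1 := continuous_subtype_val
  exact (h.matrix_elem j m).smul continuous_const

/-- The Haar probability measure on `B_l`, transported from `U(2 l + 1)` by means of a reference
basis `b₀` (as Haar measure is bi-invariant, it does not depend on `b₀`). -/
noncomputable def haarONB {l : ℕ} (b₀ : HarmonicONB l) : Measure (HarmonicONB l) :=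
  (haarUnitary l).map b₀.rotate

instance {l : ℕ} (b₀ : HarmonicONB l) : IsProbabilityMeasure (haarONB b₀) :=
  Measure.isProbabilityMeasure_map b₀.continuous_rotate.measurable.aemeasurable

/-! Fix an index m and a reference basis, and put n = 2l + 1. The m-th member of a random basis has
for coordinates the m-th column u of a Haar unitary, a uniform point of the unit sphere of ℂⁿ. For a
real observable β with |β| ≤ K, the integral of β against the squared modulus of that member is a
Hermitian form ⟨u, Hu⟩ with eigenvalues in [-K, K]. By the addition theorem
(`IsHarmonicONB.sum_integral_eq`) the trace of H is n times the mean of β, so it vanishes when β is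
centred.

The exponential moment of n t ⟨u, Hu⟩ is bounded by a complex Gaussian integral
(`lintegral_exp_column_le`), which up to πⁿ is the product of the (1 - tλ)⁻¹ over the eigenvalues λ
of H. As these sum to zero, the product is at most exp(n t² K²), and Chernoff's bound gives exp(-n
s² / (4K²)) for a deviation s (`haarUnitary_column_tail`). For s = l^(-1/8) / 2 the exponent has
order l^(3/4), enough to leave a multiple of √l after a union bound over 4n events: n members, and
the four real observables ± Re, ± Im of the centred a.

Bases with n members exist because E_l has dimension n (`map_sphericalHarmonics`,
`finrank_harmonicL2`). Let P_k be the restrictions to the sphere of homogeneous polynomials of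
degree k. Then P_{k-2} lies in P_k, and Δ + k(k+1) maps P_k into P_{k-2}. Green's formula shows that
the orthogonal complement of P_{k-2} in P_k, of dimension 2k + 1, consists of eigenfunctions;
density of polynomials and orthogonality of eigenspaces leave no others. -/

/-! ### Polar coordinates and rotation invariance of the surface measure. -/

/-- Euclidean three-space. -/
abbrev E3 : Type := EuclideanSpace ℝ (Fin 3)

theorem S2.norm_eq (x : S2) : ‖(x : E3)‖ = 1 := mem_sphere_zero_iff_norm.1 x.2

theorem S2.ne_zero (x : S2) : (x : E3) ≠ 0 := by
  intro h
  have := S2.norm_eq x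
  simp [h] at this

/-- The radial projection onto the sphere. -/
noncomputable def toS2 (x : E3) (hx : x ≠ 0) : S2 :=
  ⟨‖x‖⁻¹ • x, by
    rw [mem_sphere_zero_iff_norm]
    exact norm_smul_inv_norm (𝕜 := ℝ) hx⟩

theorem radialExtension_of_ne (f : S2 → ℂ) {x : E3} (hx : x ≠ 0) :
    radialExtension f x = f (toS2 x hx) := by
  simp [radialExtension, hx, toS2]

theorem toS2_smul {c : ℝ} (hc : 0 < c) (x : E3) (hx : x ≠ 0) :
    toS2 (c • x) (smul_ne_zero hc.ne' hx) = toS2 x hx := by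
  ext1
  simp only [toS2, norm_smul, Real.norm_of_nonneg hc.le, smul_smul]
  congr 1
  field_simp

theorem radialExtension_smul_pos (f : S2 → ℂ) {c : ℝ} (hc : 0 < c) (x : E3) :
    radialExtension f (c • x) = radialExtension f x := by
  by_cases hx : x = 0
  · simp [hx]
  · rw [radialExtension_of_ne f hx, radialExtension_of_ne f (smul_ne_zero hc.ne' hx),
      toS2_smul hc]

/-- Polar coordinates. This trades integrals over the sphere for integrals over Euclidean space,
where isometries preserve the measure and integration by parts is available. -/
theorem integral_norm_mul_radialExtension (h : ℝ → ℂ) (f : S2 → ℂ) :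
    ∫ x : E3, h ‖x‖ * radialExtension f x =
      (∫ y in Set.Ioi (0 : ℝ), (y : ℂ) ^ 2 * h y) * ∫ x, f x ∂volS2 := by
  have h3 : Module.finrank ℝ E3 - 1 = 2 := by simp
  calc
    ∫ x : E3, h ‖x‖ * radialExtension f x
      = ∫ x : ({(0)}ᶜ : Set E3), h ‖x.1‖ * radialExtension f x.1
          ∂((volume : Measure E3).comap (↑)) := by
      rw [integral_subtype_comap (measurableSet_singleton _).compl
        fun x : E3 ↦ h ‖x‖ * radialExtension f x, restrict_compl_singleton]
    _ = ∫ x, f x.1 * h x.2 ∂(volS2.prod (.volumeIoiPow (Module.finrank ℝ E3 - 1))) := by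
      rw [← (volume : Measure E3).measurePreserving_homeomorphUnitSphereProd.integral_comp
        (Homeomorph.measurableEmbedding _)]
      refine integral_congr_ae (Filter.Eventually.of_forall fun x => ?_)
      have hx : (x : E3) ≠ 0 := x.2
      simp only [radialExtension_of_ne f hx, homeomorphUnitSphereProd_apply_snd_coe]
      rw [mul_comm]
      congr 2
      ext1
      simp [toS2]
    _ = (∫ x, f x ∂volS2) * ∫ x : Set.Ioi (0 : ℝ), h x
          ∂.volumeIoiPow (Module.finrank ℝ E3 - 1) :=
      integral_prod_mul f (fun y : Set.Ioi (0 : ℝ) => h y)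
    _ = _ := by
      rw [mul_comm, h3]
      congr 1
      simp only [Measure.volumeIoiPow, ENNReal.ofReal]
      rw [integral_withDensity_eq_integral_smul,
        integral_subtype_comap measurableSet_Ioi fun a ↦ Real.toNNReal (a ^ 2) • h a]
      · refine setIntegral_congr_fun measurableSet_Ioi fun x hx ↦ ?_
        simp only [NNReal.smul_def, Real.coe_toNNReal _ (pow_nonneg (le_of_lt hx.out) 2)]
        simp
      · exact (measurable_subtype_coe.pow_const _).real_toNNReal

/-- The homeomorphism of the sphere induced by a linear isometry. -/
noncomputable def rotS2 (R : E3 ≃ₗᵢ[ℝ] E3) : C(S2, S2) :=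
  ⟨fun x => ⟨R x, by rw [mem_sphere_zero_iff_norm, R.norm_map, S2.norm_eq]⟩,
    Continuous.subtype_mk (R.continuous.comp continuous_subtype_val) _⟩

theorem radialExtension_comp_rot (f : S2 → ℂ) (R : E3 ≃ₗᵢ[ℝ] E3) :
    radialExtension (fun x => f (rotS2 R x)) = fun x => radialExtension f (R x) := by
  funext x
  by_cases hx : x = 0
  · simp [hx, radialExtension]
  · have hRx : R x ≠ 0 := by simpa using hx
    rw [radialExtension_of_ne _ hx, radialExtension_of_ne _ hRx]
    congr 1
    ext1
    simp [toS2, rotS2]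

theorem integral_comp_rot (f : S2 → ℂ) (R : E3 ≃ₗᵢ[ℝ] E3) :
    ∫ x, f (rotS2 R x) ∂volS2 = ∫ x, f x ∂volS2 := by
  -- Any weight with a finite nonzero radial factor would do; here the factor is 1/3 and cancels.
  set h : ℝ → ℂ := Set.indicator (Set.Ioc 0 1) (fun _ => 1) with hh
  have h1 := integral_norm_mul_radialExtension h f
  have h2 := integral_norm_mul_radialExtension h (fun x => f (rotS2 R x))
  have h3 : ∫ x : E3, h ‖x‖ * radialExtension (fun x => f (rotS2 R x)) x =
      ∫ x : E3, h ‖x‖ * radialExtension f x := by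
    have := R.measurePreserving.integral_comp R.toHomeomorph.measurableEmbedding
      (fun x => h ‖x‖ * radialExtension f x)
    rw [← this]
    simp [radialExtension_comp_rot]
  have h4 : (∫ y in Set.Ioi (0 : ℝ), (y : ℂ) ^ 2 * h y) = 1 / 3 := by
    have : (fun y : ℝ => (y : ℂ) ^ 2 * h y) =
        Set.indicator (Set.Ioc 0 1) (fun y : ℝ => ((y ^ 2 : ℝ) : ℂ)) := by
      funext y
      by_cases hy : y ∈ Set.Ioc (0 : ℝ) 1 <;> simp [hh, hy]
    rw [this, setIntegral_indicator measurableSet_Ioc,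
      Set.inter_eq_right.2 (fun x hx => hx.1), integral_complex_ofReal,
      ← intervalIntegral.integral_of_le zero_le_one, integral_pow]
    norm_num
  rw [h3, h1, h4] at h2
  exact (mul_left_cancel₀ (by norm_num) h2).symm

/-! ### Calculus of radial extensions and Green's formula. -/

/-- The `i`-th partial derivative. -/
noncomputable def partialDeriv (i : Fin 3) (F : E3 → ℂ) (x : E3) : ℂ :=
  fderiv ℝ F x (EuclideanSpace.single i 1)

theorem laplacian_eq_sum_partialDeriv {F : E3 → ℂ} {x : E3} (hF : ContDiffAt ℝ 2 F x) :
    Laplacian.laplacian F x = ∑ i, partialDeriv i (partialDeriv i F) x := by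
  rw [InnerProductSpace.laplacian_eq_iteratedFDeriv_orthonormalBasis F
    (EuclideanSpace.basisFun (Fin 3) ℝ)]
  refine Finset.sum_congr rfl fun i _ => ?_
  have hd : DifferentiableAt ℝ (fderiv ℝ F) x :=
    (hF.fderiv_right (m := 1) (by norm_num)).differentiableAt (by norm_num)
  rw [iteratedFDeriv_two_apply, partialDeriv]
  have : partialDeriv i F = fun y => (fderiv ℝ F y) (EuclideanSpace.single i 1) := rfl
  rw [this, fderiv_clm_apply hd (differentiableAt_const _)]
  simp

theorem sum_coord_mul_partialDeriv (F : E3 → ℂ) (x : E3) :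
    ∑ i, (x i : ℂ) * partialDeriv i F x = fderiv ℝ F x x := by
  have h := congrArg (fderiv ℝ F x) ((EuclideanSpace.basisFun (Fin 3) ℝ).sum_repr x)
  rw [← h, map_sum]
  simp [partialDeriv]

theorem partialDeriv_contDiffAt {F : E3 → ℂ} {x : E3} (hF : ContDiffAt ℝ ∞ F x) (i : Fin 3) :
    ContDiffAt ℝ ∞ (partialDeriv i F) x :=
  (hF.fderiv_right (m := ∞) (by simp)).clm_apply contDiffAt_const

theorem partialDeriv_mul {F G : E3 → ℂ} {x : E3} (hF : DifferentiableAt ℝ F x)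
    (hG : DifferentiableAt ℝ G x) (i : Fin 3) :
    partialDeriv i (fun y => F y * G y) x =
      F x * partialDeriv i G x + partialDeriv i F x * G x := by
  simp only [partialDeriv]
  rw [fderiv_fun_mul hF hG]
  simp [mul_comm]

theorem partialDeriv_congr {F G : E3 → ℂ} {x : E3} (h : F =ᶠ[nhds x] G) (i : Fin 3) :
    partialDeriv i F x = partialDeriv i G x := by
  simp only [partialDeriv, h.fderiv_eq]

theorem IsSmoothS2.contDiffAt_top {f : S2 → ℂ} (hf : IsSmoothS2 f) {x : E3} (hx : x ≠ 0) :
    ContDiffAt ℝ ∞ (radialExtension f) x :=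
  ContDiffOn.contDiffAt hf (isOpen_compl_singleton.mem_nhds hx)

/-- The extension is constant along the ray t ↦ t • x. In Green's formula this removes the
derivative of the radial cutoff. -/
theorem fderiv_radialExtension_self {f : S2 → ℂ} (hf : IsSmoothS2 f) {x : E3} (hx : x ≠ 0) :
    fderiv ℝ (radialExtension f) x x = 0 := by
  have hd : HasFDerivAt (radialExtension f) (fderiv ℝ (radialExtension f) x) ((1 : ℝ) • x) := by
    rw [one_smul]
    exact ((hf.contDiffAt_top hx).differentiableAt (by simp)).hasFDerivAt
  have h1 : HasDerivAt (fun t : ℝ => t • x) x 1 := by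
    simpa using (hasDerivAt_id (1 : ℝ)).smul_const x
  have h2 := hd.comp_hasDerivAt (1 : ℝ) h1
  have h3 : HasDerivAt ((radialExtension f) ∘ fun t : ℝ => t • x) 0 1 := by
    refine (hasDerivAt_const (1 : ℝ) (radialExtension f x)).congr_of_eventuallyEq ?_
    filter_upwards [lt_mem_nhds (zero_lt_one' ℝ)] with t ht
    simp [radialExtension_smul_pos f ht]
  exact h2.unique h3

/-- The extension is homogeneous of degree 0, so its second derivatives are homogeneous of degree
-2. -/
theorem laplacian_radialExtension {f : S2 → ℂ} {x : E3} (hx : x ≠ 0) :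
    Laplacian.laplacian (radialExtension f) x =
      ((‖x‖ ^ 2)⁻¹ : ℝ) * radialExtension (laplaceS2 f) x := by
  have hc : 0 < ‖x‖⁻¹ := inv_pos.2 (norm_pos_iff.2 hx)
  set c := ‖x‖⁻¹ with hcdef
  have hfun : (fun y => radialExtension f (c • y)) = radialExtension f :=
    funext fun y => radialExtension_smul_pos f hc y
  have h1 : ∀ y, fderiv ℝ (radialExtension f) y = c • fderiv ℝ (radialExtension f) (c • y) := by
    intro y
    conv_lhs => rw [← hfun]
    exact fderiv_comp_smul c
  have h2 : fderiv ℝ (fderiv ℝ (radialExtension f)) x =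
      c • c • fderiv ℝ (fderiv ℝ (radialExtension f)) (c • x) := by
    have : fderiv ℝ (radialExtension f) =
        c • fun y => fderiv ℝ (radialExtension f) (c • y) := funext h1
    conv_lhs => rw [this]
    refine (congrFun (fderiv_const_smul_field (𝕜 := ℝ)
      (f := fun y => fderiv ℝ (radialExtension f) (c • y)) c) x).trans ?_
    rw [Pi.smul_apply, fderiv_comp_smul]
  rw [radialExtension_of_ne _ hx, laplaceS2,
    InnerProductSpace.laplacian_eq_iteratedFDeriv_orthonormalBasis _
    (EuclideanSpace.basisFun (Fin 3) ℝ)]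
  simp only [iteratedFDeriv_two_apply, toS2, ← hcdef]
  rw [h2, Finset.mul_sum]
  refine Finset.sum_congr rfl fun i _ => ?_
  simp [hcdef]
  ring

theorem fderiv_comp_sq_norm {ψ : ℝ → ℝ} {x : E3} (hψ : DifferentiableAt ℝ ψ (‖x‖ ^ 2))
    (v : E3) :
    fderiv ℝ (fun y : E3 => ((ψ (‖y‖ ^ 2) : ℝ) : ℂ)) x v =
      ((2 * deriv ψ (‖x‖ ^ 2) * inner ℝ x v : ℝ) : ℂ) := by
  have h1 : HasFDerivAt (fun y : E3 => ‖y‖ ^ 2) (2 • (innerSL ℝ x)) x :=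
    (hasStrictFDerivAt_norm_sq x).hasFDerivAt
  have h2 := hψ.hasDerivAt.comp_hasFDerivAt x h1
  have h3 := (Complex.ofRealCLM.hasFDerivAt (x := ψ (‖x‖ ^ 2))).comp x h2
  have h4 : (fun y : E3 => ((ψ (‖y‖ ^ 2) : ℝ) : ℂ)) =
    (Complex.ofRealCLM ∘ (ψ ∘ fun y : E3 => ‖y‖ ^ 2)) := rfl
  rw [h4, h3.fderiv]
  simp
  ring

theorem integral_partialDeriv_eq_zero {W : E3 → ℂ} (hW : ContDiff ℝ 1 W)
    (hc : HasCompactSupport W) (i : Fin 3) : ∫ x, partialDeriv i W x = 0 := by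
  have hd : HasCompactSupport (partialDeriv i W) := hc.fderiv_apply ℝ _
  have hcont : Continuous (partialDeriv i W) :=
    (hW.continuous_fderiv (by norm_num)).clm_apply continuous_const
  have h := integral_mul_fderiv_eq_neg_fderiv_mul_of_integrable (μ := (volume : Measure E3))
    (f := fun _ => (1 : ℂ)) (g := W) (v := EuclideanSpace.single i 1)
    (by simp) (by simp only [one_mul]; exact hcont.integrable_of_hasCompactSupport hd)
    (by simp only [one_mul]; exact hW.continuous.integrable_of_hasCompactSupport hc)
    (fun x _ => differentiableAt_const _)
    (fun x _ => hW.differentiable (by norm_num) x)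
  simpa [partialDeriv] using h

/-- A smooth bump function around `1`, used to cut off radially. -/
noncomputable def radialBump : ContDiffBump (1 : ℝ) := ⟨1 / 4, 1 / 2, by norm_num, by norm_num⟩

theorem radialBump_eq_zero_of_norm {x : E3} (hx : 2 ≤ ‖x‖) : radialBump (‖x‖ ^ 2) = 0 := by
  apply radialBump.zero_of_le_dist
  rw [Real.dist_eq]
  have : 3 ≤ ‖x‖ ^ 2 - 1 := by nlinarith
  rw [abs_of_nonneg (by linarith)]
  simp only [radialBump]
  linarith

theorem radialBump_eventually_zero {x : E3} (hx : x = 0) :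
    ∀ᶠ y in nhds x, radialBump (‖y‖ ^ 2) = 0 := by
  have hcont : Continuous fun y : E3 => ‖y‖ ^ 2 := by fun_prop
  have h0 : ‖x‖ ^ 2 < 1 / 2 := by simp [hx]
  filter_upwards [hcont.continuousAt.eventually_lt_const h0] with y hy
  apply radialBump.zero_of_le_dist
  rw [Real.dist_eq, abs_sub_comm, abs_of_nonneg (by linarith)]
  simp only [radialBump]
  linarith

theorem integral_radialBump_pos : 0 < ∫ y in Set.Ioi (0 : ℝ), radialBump (y ^ 2) := by
  have hcont : Continuous fun y : ℝ => radialBump (y ^ 2) := by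
    have := radialBump.continuous
    fun_prop
  have hsupp : HasCompactSupport fun y : ℝ => radialBump (y ^ 2) := by
    refine HasCompactSupport.intro (isCompact_closedBall (0 : ℝ) 2) fun y hy => ?_
    apply radialBump.zero_of_le_dist
    have hy' : 2 < |y| := by simpa using hy
    have : 4 < y ^ 2 := by rw [← sq_abs]; nlinarith
    rw [Real.dist_eq, abs_of_nonneg (by linarith)]
    simp only [radialBump]
    linarith
  rw [setIntegral_pos_iff_support_of_nonneg_ae
    (Filter.Eventually.of_forall fun y => radialBump.nonneg)
    (hcont.integrable_of_hasCompactSupport hsupp).integrableOn]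
  have hopen : IsOpen ((Function.support fun y : ℝ => radialBump (y ^ 2)) ∩ Set.Ioi 0) :=
    hcont.isOpen_support.inter isOpen_Ioi
  refine hopen.measure_pos _ ⟨1, ?_, by simp⟩
  have : radialBump ((1 : ℝ) ^ 2) = 1 := by
    rw [one_pow]
    exact radialBump.one_of_mem_closedBall (by simp [radialBump])
  simp only [Function.mem_support, this]
  norm_num

/-- Green's formula on the sphere: the Laplace–Beltrami operator is symmetric. -/
theorem integral_mul_laplaceS2_comm {f g : S2 → ℂ} (hf : IsSmoothS2 f) (hg : IsSmoothS2 g) :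
    ∫ x, (g x * laplaceS2 f x - f x * laplaceS2 g x) ∂volS2 = 0 := by
  set F := radialExtension f with hF
  set G := radialExtension g with hG
  set η : E3 → ℂ := fun x => ((radialBump (‖x‖ ^ 2) : ℝ) : ℂ) with hη
  -- The field η V vanishes near the origin and has compact support, so its divergence integrates to
  -- zero over Euclidean space.
  set V : Fin 3 → E3 → ℂ :=
    fun i x => G x * partialDeriv i F x - F x * partialDeriv i G x with hV
  have hηs : ContDiff ℝ ∞ η :=
    Complex.ofRealCLM.contDiff.comp (radialBump.contDiff.comp (contDiff_norm_sq ℝ))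
  have hη0 : ∀ᶠ y in nhds (0 : E3), η y = 0 := by
    filter_upwards [radialBump_eventually_zero rfl] with y hy
    simp [hη, hy]
  have hVs : ∀ i, ∀ x ≠ 0, ContDiffAt ℝ ∞ (V i) x := fun i x hx =>
    ((hg.contDiffAt_top hx).mul (partialDeriv_contDiffAt (hf.contDiffAt_top hx) i)).sub
      ((hf.contDiffAt_top hx).mul (partialDeriv_contDiffAt (hg.contDiffAt_top hx) i))
  have hWs : ∀ i, ContDiff ℝ 1 (fun x => η x * V i x) := by
    intro i
    rw [contDiff_iff_contDiffAt]
    intro x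
    by_cases hx : x = 0
    · refine (contDiffAt_const (c := (0 : ℂ))).congr_of_eventuallyEq ?_
      rw [hx]
      filter_upwards [hη0] with y hy
      simp [hy]
    · exact ((hηs.contDiffAt).mul (hVs i x hx)).of_le (by norm_cast)
  have hWc : ∀ i, HasCompactSupport (fun x => η x * V i x) := by
    intro i
    refine HasCompactSupport.intro (isCompact_closedBall (0 : E3) 2) fun y hy => ?_
    have hy' : 2 < ‖y‖ := by simpa using hy
    simp [hη, radialBump_eq_zero_of_norm hy'.le]
  have hsum : ∫ x : E3, ∑ i, partialDeriv i (fun x => η x * V i x) x = 0 := by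
    rw [integral_finsetSum]
    · exact Finset.sum_eq_zero fun i _ => integral_partialDeriv_eq_zero (hWs i) (hWc i) i
    · intro i _
      exact (((hWs i).continuous_fderiv (by norm_num)).clm_apply
        continuous_const).integrable_of_hasCompactSupport ((hWc i).fderiv_apply ℝ _)
  have hpt : ∀ x : E3, ∑ i, partialDeriv i (fun x => η x * V i x) x =
      (((radialBump (‖x‖ ^ 2) * (‖x‖ ^ 2)⁻¹ : ℝ) : ℂ)) *
        radialExtension (fun x => g x * laplaceS2 f x - f x * laplaceS2 g x) x := by
    intro x
    by_cases hx : x = 0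
    · have : ∀ i, partialDeriv i (fun x => η x * V i x) x = 0 := by
        intro i
        rw [partialDeriv_congr (G := fun _ => 0)]
        · simp [partialDeriv]
        · rw [hx]
          filter_upwards [hη0] with y hy
          simp [hy]
      rw [Finset.sum_eq_zero fun i _ => this i]
      simp [hx]
    have hFx := hf.contDiffAt_top hx
    have hGx := hg.contDiffAt_top hx
    have hd : ∀ {H : E3 → ℂ}, ContDiffAt ℝ ∞ H x → DifferentiableAt ℝ H x :=
      fun h => h.differentiableAt (by simp)
    have hVi : ∀ i, partialDeriv i (V i) x =
        G x * partialDeriv i (partialDeriv i F) x - F x * partialDeriv i (partialDeriv i G) x := by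
      intro i
      have h1 := hd (partialDeriv_contDiffAt hFx i)
      have h2 := hd (partialDeriv_contDiffAt hGx i)
      have : partialDeriv i (V i) x = partialDeriv i (fun y => G y * partialDeriv i F y) x -
          partialDeriv i (fun y => F y * partialDeriv i G y) x := by
        simp only [partialDeriv, hV]
        rw [fderiv_fun_sub]
        · rfl
        · exact (hd hGx).mul h1
        · exact (hd hFx).mul h2
      rw [this, partialDeriv_mul (hd hGx) h1, partialDeriv_mul (hd hFx) h2]
      ring
    have hηi : ∀ i, partialDeriv i η x = ((2 * deriv radialBump (‖x‖ ^ 2) : ℝ) : ℂ) * (x i : ℂ) := by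
      intro i
      have := fderiv_comp_sq_norm (ψ := radialBump) (x := x)
        (radialBump.contDiff (n := 1) |>.differentiable (by norm_num) _)
        (EuclideanSpace.single i 1)
      simp only [partialDeriv, hη]
      rw [this]
      simp [EuclideanSpace.inner_single_right]
    -- V has no radial component while the gradient of η is radial, so the cutoff contributes no
    -- term to the divergence.
    have hrad : ∑ i, (x i : ℂ) * V i x = 0 := by
      have h1 := sum_coord_mul_partialDeriv F x
      have h2 := sum_coord_mul_partialDeriv G x
      rw [fderiv_radialExtension_self hf hx] at h1
      rw [fderiv_radialExtension_self hg hx] at h2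
      calc ∑ i, (x i : ℂ) * V i x = G x * ∑ i, (x i : ℂ) * partialDeriv i F x -
            F x * ∑ i, (x i : ℂ) * partialDeriv i G x := by
            rw [Finset.mul_sum, Finset.mul_sum, ← Finset.sum_sub_distrib]
            refine Finset.sum_congr rfl fun i _ => ?_
            simp only [hV]
            ring
        _ = 0 := by rw [h1, h2]; ring
    calc ∑ i, partialDeriv i (fun x => η x * V i x) x
        = η x * (G x * ∑ i, partialDeriv i (partialDeriv i F) x -
            F x * ∑ i, partialDeriv i (partialDeriv i G) x) +
          ((2 * deriv radialBump (‖x‖ ^ 2) : ℝ) : ℂ) * ∑ i, (x i : ℂ) * V i x := by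
          rw [Finset.mul_sum, Finset.mul_sum, ← Finset.sum_sub_distrib, Finset.mul_sum,
            Finset.mul_sum, ← Finset.sum_add_distrib]
          refine Finset.sum_congr rfl fun i _ => ?_
          rw [partialDeriv_mul (hd hηs.contDiffAt) (hd (hVs i x hx)), hVi, hηi]
          ring
      _ = _ := by
          rw [hrad, ← laplacian_eq_sum_partialDeriv (hFx.of_le (by norm_cast)),
            ← laplacian_eq_sum_partialDeriv (hGx.of_le (by norm_cast)),
            laplacian_radialExtension hx, laplacian_radialExtension hx]
          simp only [radialExtension_of_ne _ hx, hF, hG, hη]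
          push_cast
          ring
  rw [integral_congr_ae (Filter.Eventually.of_forall hpt),
    integral_norm_mul_radialExtension
      (fun r => ((radialBump (r ^ 2) * (r ^ 2)⁻¹ : ℝ) : ℂ))] at hsum
  -- The Jacobian y² cancels the factor ‖x‖⁻² of the Laplacians, leaving a positive radial integral
  -- to divide by.
  have hI : (∫ y in Set.Ioi (0 : ℝ),
      (y : ℂ) ^ 2 * ((radialBump (y ^ 2) * (y ^ 2)⁻¹ : ℝ) : ℂ)) =
      ((∫ y in Set.Ioi (0 : ℝ), radialBump (y ^ 2) : ℝ) : ℂ) := by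
    rw [← integral_complex_ofReal]
    refine setIntegral_congr_fun measurableSet_Ioi fun y hy => ?_
    have hy0 : (y : ℂ) ≠ 0 := by exact_mod_cast (ne_of_gt hy)
    push_cast
    field_simp
  rw [hI] at hsum
  refine (mul_eq_zero.1 hsum).resolve_left ?_
  exact_mod_cast integral_radialBump_pos.ne'

/-! ### Homogeneous polynomials restricted to the sphere. -/

open MvPolynomial in
/-- The function on Euclidean three-space defined by a polynomial. -/
noncomputable def polyFun (p : MvPolynomial (Fin 3) ℂ) (x : E3) : ℂ :=
  eval (fun i => (x i : ℂ)) p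

theorem contDiff_polyFun (p : MvPolynomial (Fin 3) ℂ) : ContDiff ℝ ∞ (polyFun p) := by
  induction p using MvPolynomial.induction_on with
  | C c =>
    have : polyFun (MvPolynomial.C c) = fun _ => c := by funext x; simp [polyFun]
    rw [this]
    exact contDiff_const
  | add p q hp hq =>
    have : polyFun (p + q) = fun x => polyFun p x + polyFun q x := by
      funext x; simp [polyFun]
    rw [this]
    exact hp.add hq
  | mul_X p i hp =>
    have : polyFun (p * MvPolynomial.X i) = fun x => polyFun p x * (x i : ℂ) := by
      funext x; simp [polyFun]
    rw [this]
    exact hp.mul (Complex.ofRealCLM.contDiff.comp (by fun_prop))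

theorem partialDeriv_coord (i j : Fin 3) (x : E3) :
    partialDeriv i (fun y => (y j : ℂ)) x = if i = j then 1 else 0 := by
  have h : HasFDerivAt (fun y : E3 => (y j : ℂ))
      (Complex.ofRealCLM ∘L (EuclideanSpace.proj j : E3 →L[ℝ] ℝ)) x :=
    (Complex.ofRealCLM ∘L (EuclideanSpace.proj j : E3 →L[ℝ] ℝ)).hasFDerivAt
  rw [partialDeriv, h.fderiv]
  by_cases hij : i = j
  · simp [hij]
  · simp [hij, Ne.symm hij]

theorem differentiable_polyFun (p : MvPolynomial (Fin 3) ℂ) : Differentiable ℝ (polyFun p) :=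
  (contDiff_polyFun p).differentiable (by simp)

theorem differentiable_coord (j : Fin 3) : Differentiable ℝ fun y : E3 => (y j : ℂ) :=
  (Complex.ofRealCLM ∘L (EuclideanSpace.proj j : E3 →L[ℝ] ℝ)).differentiable

theorem partialDeriv_polyFun (i : Fin 3) (p : MvPolynomial (Fin 3) ℂ) :
    partialDeriv i (polyFun p) = polyFun (MvPolynomial.pderiv i p) := by
  funext x
  induction p using MvPolynomial.induction_on with
  | C c =>
    have : polyFun (MvPolynomial.C c) = fun _ => c := by funext x; simp [polyFun]
    rw [this]
    simp [polyFun, partialDeriv]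
  | add p q hp hq =>
    have : polyFun (p + q) = fun x => polyFun p x + polyFun q x := by
      funext x; simp [polyFun]
    rw [this, partialDeriv, fderiv_fun_add (differentiable_polyFun p x)
      (differentiable_polyFun q x)]
    simp only [partialDeriv] at hp hq
    simp [hp, hq, polyFun]
  | mul_X p j hp =>
    have : polyFun (p * MvPolynomial.X j) = fun x => polyFun p x * (x j : ℂ) := by
      funext x; simp [polyFun]
    rw [this, partialDeriv_mul (differentiable_polyFun p x) (differentiable_coord j x), hp,
      partialDeriv_coord]
    by_cases hij : i = j
    · simp [polyFun, Derivation.leibniz, hij]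
      ring
    · simp [polyFun, Derivation.leibniz, hij, MvPolynomial.pderiv_X_of_ne (Ne.symm hij)]
      ring

theorem polyFun_smul {p : MvPolynomial (Fin 3) ℂ} {k : ℕ} (hp : p.IsHomogeneous k) (c : ℝ)
    (x : E3) : polyFun p (c • x) = (c : ℂ) ^ k * polyFun p x := by
  simp only [polyFun, MvPolynomial.eval_eq', Finset.mul_sum]
  refine Finset.sum_congr rfl fun d hd => ?_
  have hdeg : ∑ i, d i = k := by
    have := hp (MvPolynomial.mem_support_iff.1 hd)
    rw [← this, Finsupp.weight_apply, Finsupp.sum_fintype _ _ (by simp)]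
    simp
  have : ∏ i, (((c • x : E3) i : ℝ) : ℂ) ^ d i = (c : ℂ) ^ k * ∏ i, ((x i : ℝ) : ℂ) ^ d i := by
    rw [← hdeg, ← Finset.prod_pow_eq_pow_sum, ← Finset.prod_mul_distrib]
    refine Finset.prod_congr rfl fun i _ => ?_
    simp [mul_pow]
  rw [this]
  ring

theorem sum_coord_mul_partialDeriv_polyFun {p : MvPolynomial (Fin 3) ℂ} {k : ℕ}
    (hp : p.IsHomogeneous k) (x : E3) :
    ∑ i, (x i : ℂ) * partialDeriv i (polyFun p) x = k * polyFun p x := by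
  have h := congrArg (fun q => polyFun q x) hp.sum_X_mul_pderiv
  simp only [partialDeriv_polyFun]
  simpa [polyFun] using h

/-- The restriction of polynomials to the sphere. -/
noncomputable def polyS2 : MvPolynomial (Fin 3) ℂ →ₐ[ℂ] C(S2, ℂ) :=
  MvPolynomial.aeval fun i => ⟨fun x : S2 => ((x : E3) i : ℂ), by fun_prop⟩

theorem polyS2_apply (p : MvPolynomial (Fin 3) ℂ) (x : S2) : polyS2 p x = polyFun p x := by
  induction p using MvPolynomial.induction_on with
  | C c => simp [polyS2, polyFun]
  | add p q hp hq => simp [hp, hq, polyFun]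
  | mul_X p j hp => simp [hp, polyFun]; simp [polyS2]

/-- The power `‖x‖ ^ (2 s)` as a complex-valued function. -/
noncomputable def normPow (s : ℝ) (x : E3) : ℂ := (((‖x‖ ^ 2) ^ s : ℝ) : ℂ)

theorem contDiffAt_normPow (s : ℝ) {x : E3} (hx : x ≠ 0) : ContDiffAt ℝ ∞ (normPow s) x := by
  have h1 : ContDiffAt ℝ ∞ (fun y : E3 => ‖y‖ ^ 2) x := (contDiff_norm_sq ℝ).contDiffAt
  have h2 : ‖x‖ ^ 2 ≠ 0 := by simpa using hx
  exact Complex.ofRealCLM.contDiff.contDiffAt.comp x (h1.rpow_const_of_ne h2)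

theorem partialDeriv_normPow (s : ℝ) {x : E3} (hx : x ≠ 0) (i : Fin 3) :
    partialDeriv i (normPow s) x = 2 * s * (x i : ℂ) * normPow (s - 1) x := by
  have h2 : ‖x‖ ^ 2 ≠ 0 := by simpa using hx
  have hd : HasDerivAt (fun t : ℝ => t ^ s) (s * (‖x‖ ^ 2) ^ (s - 1)) (‖x‖ ^ 2) :=
    Real.hasDerivAt_rpow_const (Or.inl h2)
  have := fderiv_comp_sq_norm (ψ := fun t : ℝ => t ^ s) (x := x) hd.differentiableAt
    (EuclideanSpace.single i 1)
  unfold partialDeriv normPow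
  rw [this, hd.deriv]
  simp [EuclideanSpace.inner_single_right]
  ring

theorem normPow_coe (s : ℝ) (x : S2) : normPow s (x : E3) = 1 := by
  simp [normPow]

theorem radialExtension_polyS2 {p : MvPolynomial (Fin 3) ℂ} {k : ℕ} (hp : p.IsHomogeneous k)
    {x : E3} (hx : x ≠ 0) :
    radialExtension (polyS2 p) x = normPow (-(k / 2)) x * polyFun p x := by
  have h0 := norm_pos_iff.2 hx
  rw [radialExtension_of_ne _ hx, polyS2_apply, toS2, polyFun_smul hp]
  congr 1
  rw [normPow, ← Real.rpow_natCast_mul h0.le]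
  have : ((2 : ℕ) : ℝ) * -((k : ℝ) / 2) = -(k : ℝ) := by push_cast; ring
  rw [this, Real.rpow_neg h0.le, Real.rpow_natCast]
  simp

theorem isSmoothS2_polyS2_of_isHomogeneous {p : MvPolynomial (Fin 3) ℂ} {k : ℕ}
    (hp : p.IsHomogeneous k) : IsSmoothS2 (polyS2 p) := by
  intro x hx
  have hx' : x ≠ 0 := hx
  refine ContDiffAt.contDiffWithinAt ?_
  refine ((contDiffAt_normPow (-(k / 2)) hx').mul
    (contDiff_polyFun p).contDiffAt).congr_of_eventuallyEq ?_
  filter_upwards [isOpen_compl_singleton.mem_nhds hx] with y hy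
  exact radialExtension_polyS2 hp hy

/-- The Laplacian of a polynomial. -/
noncomputable def polyLaplacian (p : MvPolynomial (Fin 3) ℂ) : MvPolynomial (Fin 3) ℂ :=
  ∑ i, MvPolynomial.pderiv i (MvPolynomial.pderiv i p)

theorem sum_sq_coord_S2 (x : S2) : ∑ i, (((x : E3) i : ℂ)) ^ 2 = 1 := by
  have := EuclideanSpace.norm_sq_eq (x : E3)
  rw [S2.norm_eq] at this
  simp only [Real.norm_eq_abs, sq_abs, one_pow] at this
  exact_mod_cast this.symm

/-- The radial extension is ‖x‖^(2s) p with s = -k/2. On the sphere, the product rule and Euler's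
identity give its Laplacian as Δp + (4sk + 6s + 4s(s - 1)) p, and the bracket equals -k(k + 1). -/
theorem laplaceS2_polyS2 {p : MvPolynomial (Fin 3) ℂ} {k : ℕ} (hp : p.IsHomogeneous k) (x : S2) :
    laplaceS2 (polyS2 p) x = polyS2 (polyLaplacian p) x - k * (k + 1) * polyS2 p x := by
  have hx : (x : E3) ≠ 0 := x.ne_zero
  have hnear : ∀ᶠ y in nhds (x : E3), y ≠ 0 := isOpen_compl_singleton.mem_nhds hx
  set s : ℝ := -(k / 2) with hs
  have hN : ∀ t, ∀ y : E3, y ≠ 0 → DifferentiableAt ℝ (normPow t) y := fun t y hy =>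
    (contDiffAt_normPow t hy).differentiableAt (by simp)
  have hF := differentiable_polyFun p
  rw [laplaceS2, laplacian_eq_sum_partialDeriv
    ((isSmoothS2_polyS2_of_isHomogeneous hp).contDiffAt x)]
  have h1 : ∀ i, partialDeriv i (radialExtension (polyS2 p)) =ᶠ[nhds (x : E3)]
      fun y => normPow s y * polyFun (MvPolynomial.pderiv i p) y +
        (2 * s * ((y i : ℂ) * normPow (s - 1) y)) * polyFun p y := by
    intro i
    filter_upwards [hnear] with y hy
    rw [partialDeriv_congr (G := fun y => normPow s y * polyFun p y),
      partialDeriv_mul (hN s y hy) (hF y), partialDeriv_normPow s hy, partialDeriv_polyFun]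
    · ring
    · filter_upwards [isOpen_compl_singleton.mem_nhds hy] with z hz
      exact radialExtension_polyS2 hp hz
  have h2 : ∀ i, partialDeriv i (partialDeriv i (radialExtension (polyS2 p))) x =
      polyFun (MvPolynomial.pderiv i (MvPolynomial.pderiv i p)) x +
        4 * s * (((x : E3) i : ℂ) * partialDeriv i (polyFun p) x) +
        2 * s * polyFun p x + 4 * s * (s - 1) * (((x : E3) i : ℂ) ^ 2) * polyFun p x := by
    intro i
    have hA : DifferentiableAt ℝ (fun y : E3 => normPow s y * polyFun (MvPolynomial.pderiv i p) y)
        x := (hN s x hx).mul (differentiable_polyFun _ _)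
    have hB0 : DifferentiableAt ℝ (fun y : E3 => (y i : ℂ) * normPow (s - 1) y) (x : E3) :=
      (differentiable_coord i x).mul (hN (s - 1) x hx)
    have hB1 : DifferentiableAt ℝ (fun y : E3 => 2 * (s : ℂ) * ((y i : ℂ) * normPow (s - 1) y))
        (x : E3) := hB0.const_mul _
    have hB : DifferentiableAt ℝ (fun y : E3 => 2 * (s : ℂ) * ((y i : ℂ) * normPow (s - 1) y) *
        polyFun p y) (x : E3) := hB1.mul (hF x)
    have hsplit : partialDeriv i (fun y => normPow s y * polyFun (MvPolynomial.pderiv i p) y +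
        (2 * s * ((y i : ℂ) * normPow (s - 1) y)) * polyFun p y) x =
        partialDeriv i (fun y => normPow s y * polyFun (MvPolynomial.pderiv i p) y) x +
        partialDeriv i (fun y => (2 * s * ((y i : ℂ) * normPow (s - 1) y)) * polyFun p y) x := by
      rw [partialDeriv, fderiv_fun_add hA hB]
      rfl
    have hconst : partialDeriv i (fun y => 2 * (s : ℂ) * ((y i : ℂ) * normPow (s - 1) y)) x =
        2 * s * partialDeriv i (fun y => (y i : ℂ) * normPow (s - 1) y) x := by
      rw [partialDeriv, fderiv_const_mul hB0]
      rfl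
    rw [partialDeriv_congr (h1 i), hsplit, partialDeriv_mul (hN s x hx)
      (differentiable_polyFun _ _), partialDeriv_mul hB1 (hF x), hconst,
      partialDeriv_mul (differentiable_coord i x) (hN (s - 1) x hx), partialDeriv_normPow s hx,
      partialDeriv_normPow (s - 1) hx, partialDeriv_coord, partialDeriv_polyFun,
      partialDeriv_polyFun]
    simp only [normPow_coe]
    push_cast
    simp
    ring
  have hsq := sum_sq_coord_S2 x
  have hEuler := sum_coord_mul_partialDeriv_polyFun hp (x : E3)
  have hL : polyFun (polyLaplacian p) x =
      ∑ i, polyFun (MvPolynomial.pderiv i (MvPolynomial.pderiv i p)) x := by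
    simp [polyLaplacian, polyFun]
  have hS : ∑ i, 4 * (s : ℂ) * (s - 1) * (((x : E3) i : ℂ) ^ 2) * polyFun p x =
      4 * s * (s - 1) * polyFun p x := by
    rw [← Finset.sum_mul, ← Finset.mul_sum, hsq]
    ring
  simp only [h2]
  rw [Finset.sum_add_distrib, Finset.sum_add_distrib, Finset.sum_add_distrib, hS,
    ← Finset.mul_sum, hEuler, polyS2_apply, polyS2_apply, hL]
  simp only [Finset.sum_const, Finset.card_univ, Fintype.card_fin, hs]
  push_cast
  simp only [nsmul_eq_mul]
  push_cast
  ring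

/-- Restrictions to the sphere of homogeneous polynomials of degree `k`. -/
noncomputable def homPolyS2 (k : ℕ) : Submodule ℂ C(S2, ℂ) :=
  (MvPolynomial.homogeneousSubmodule (Fin 3) ℂ k).map polyS2.toLinearMap

/-- The space `homPolyS2 (k - 2)`, understood to be trivial when `k < 2`. -/
noncomputable def homPolyS2Prev : ℕ → Submodule ℂ C(S2, ℂ)
  | 0 => ⊥
  | 1 => ⊥
  | k + 2 => homPolyS2 k

theorem polyS2_mem {p : MvPolynomial (Fin 3) ℂ} {k : ℕ} (hp : p.IsHomogeneous k) :
    polyS2 p ∈ homPolyS2 k :=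
  ⟨p, (MvPolynomial.mem_homogeneousSubmodule _ _).2 hp, rfl⟩

theorem mem_homPolyS2 {f : C(S2, ℂ)} {k : ℕ} (hf : f ∈ homPolyS2 k) :
    ∃ p : MvPolynomial (Fin 3) ℂ, p.IsHomogeneous k ∧ polyS2 p = f := by
  obtain ⟨p, hp, rfl⟩ := hf
  exact ⟨p, (MvPolynomial.mem_homogeneousSubmodule _ _).1 hp, rfl⟩

/-- Multiplying by the sum of the squared coordinates raises the degree by two and changes nothing
on the sphere. -/
theorem homPolyS2Prev_le (k : ℕ) : homPolyS2Prev k ≤ homPolyS2 k := by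
  match k with
  | 0 => exact bot_le
  | 1 => exact bot_le
  | k + 2 =>
    intro f hf
    obtain ⟨p, hp, rfl⟩ := mem_homPolyS2 hf
    have hr : (∑ i : Fin 3, (MvPolynomial.X i : MvPolynomial (Fin 3) ℂ) ^ 2).IsHomogeneous 2 :=
      MvPolynomial.IsHomogeneous.sum _ _ _ fun i _ => by
        simpa using (MvPolynomial.isHomogeneous_X ℂ i).pow 2
    have h := polyS2_mem (hp.mul hr)
    convert h using 1
    ext x
    rw [polyS2_apply, polyS2_apply]
    have := sum_sq_coord_S2 x
    simp only [polyFun, map_mul, map_sum, map_pow, MvPolynomial.eval_X, this, mul_one]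

theorem polyS2_polyLaplacian_mem {p : MvPolynomial (Fin 3) ℂ} {k : ℕ} (hp : p.IsHomogeneous k) :
    polyS2 (polyLaplacian p) ∈ homPolyS2Prev k := by
  match k with
  | 0 =>
    have h : ∀ i : Fin 3, MvPolynomial.pderiv i p = 0 := by
      intro i
      rw [← MvPolynomial.totalDegree_zero_iff_isHomogeneous,
        MvPolynomial.totalDegree_eq_zero_iff_eq_C] at hp
      rw [hp, MvPolynomial.pderiv_C]
    simp [polyLaplacian, h, homPolyS2Prev]
  | 1 =>
    have h : ∀ i : Fin 3, MvPolynomial.pderiv i (MvPolynomial.pderiv i p) = 0 := by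
      intro i
      have hp' := hp.pderiv (i := i)
      rw [← MvPolynomial.totalDegree_zero_iff_isHomogeneous,
        MvPolynomial.totalDegree_eq_zero_iff_eq_C] at hp'
      rw [hp', MvPolynomial.pderiv_C]
    simp [polyLaplacian, h, homPolyS2Prev]
  | k + 2 =>
    exact polyS2_mem (MvPolynomial.IsHomogeneous.sum _ _ _ fun i _ => hp.pderiv.pderiv)

theorem isSmoothS2_of_mem_homPolyS2 {f : C(S2, ℂ)} {k : ℕ} (hf : f ∈ homPolyS2 k) :
    IsSmoothS2 f := by
  obtain ⟨p, hp, rfl⟩ := mem_homPolyS2 hf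
  exact isSmoothS2_polyS2_of_isHomogeneous hp

theorem exists_laplaceS2_add_mem_prev {f : C(S2, ℂ)} {k : ℕ} (hf : f ∈ homPolyS2 k) :
    ∃ h ∈ homPolyS2Prev k, ∀ x, laplaceS2 f x + k * (k + 1) * f x = h x := by
  obtain ⟨p, hp, rfl⟩ := mem_homPolyS2 hf
  refine ⟨_, polyS2_polyLaplacian_mem hp, fun x => ?_⟩
  rw [laplaceS2_polyS2 hp]
  ring

/-- In degree j the Laplacian is -j(j + 1) plus a map lowering the degree by two, so the nesting
makes `homPolyS2Prev k` stable. -/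
theorem exists_laplaceS2_prev {f : C(S2, ℂ)} {k : ℕ} (hf : f ∈ homPolyS2Prev k) :
    ∃ h ∈ homPolyS2Prev k, ∀ x, laplaceS2 f x = h x := by
  match k with
  | 0 | 1 =>
    have hf0 : f = 0 := by simpa [homPolyS2Prev] using hf
    have hz := (sphericalHarmonics 0).zero_mem.2
    refine ⟨0, Submodule.zero_mem _, fun x => ?_⟩
    simpa [hf0] using hz x
  | k + 2 =>
    obtain ⟨h, hh, hx⟩ := exists_laplaceS2_add_mem_prev (k := k) hf
    refine ⟨h - ((k : ℂ) * (k + 1)) • f, Submodule.sub_mem _ (homPolyS2Prev_le k hh)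
      (Submodule.smul_mem _ _ hf), fun x => ?_⟩
    simp [← hx x]

theorem polyS2_injective_of_isHomogeneous {p : MvPolynomial (Fin 3) ℂ} {k : ℕ}
    (hp : p.IsHomogeneous k) (h : polyS2 p = 0) : p = 0 := by
  have h0 : ∀ x : E3, x ≠ 0 → polyFun p x = 0 := by
    intro x hx
    have h1 := polyFun_smul hp ‖x‖⁻¹ x
    have h2 : polyFun p (‖x‖⁻¹ • x) = 0 := by
      have := polyS2_apply p (toS2 x hx)
      rw [h] at this
      exact this.symm
    rw [h2] at h1
    exact (mul_eq_zero.1 h1.symm).resolve_left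
      (pow_ne_zero _ (by exact_mod_cast inv_ne_zero (norm_ne_zero_iff.2 hx)))
  -- Points with positive real coordinates avoid the origin and form a product of infinite sets,
  -- which determines a polynomial.
  refine MvPolynomial.funext_set (s := fun _ => (fun t : ℝ => (t : ℂ)) '' Set.Ioi 0)
    (fun _ => (Set.Ioi_infinite (0 : ℝ)).image Complex.ofReal_injective.injOn) fun x hx => ?_
  choose y hy hyx using fun i => hx i (Set.mem_univ i)
  have hx' : x = fun i => (((WithLp.toLp 2 y : E3) i : ℝ) : ℂ) := by
    funext i
    exact (hyx i).symm
  have hne : (WithLp.toLp 2 y : E3) ≠ 0 := by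
    intro h
    have := congrArg (fun v : E3 => v 0) h
    have h3 := hy 0
    simp at this
    simp [this] at h3
  have := h0 _ hne
  rw [polyFun, ← hx'] at this
  simpa using this

instance (k : ℕ) : FiniteDimensional ℂ (homPolyS2 k) := by
  have : FiniteDimensional ℂ (MvPolynomial.homogeneousSubmodule (Fin 3) ℂ k) :=
    Module.Finite.iff_fg.2 (MvPolynomial.homogeneousSubmodule_fg _ _ k)
  exact Module.Finite.map _ _

theorem finrank_homogeneousSubmodule (k : ℕ) :
    Module.finrank ℂ (MvPolynomial.homogeneousSubmodule (Fin 3) ℂ k) = (k + 2).choose 2 := by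
  rw [MvPolynomial.homogeneousSubmodule_eq_finsupp_supported]
  rw [(AddMonoidAlgebra.supportedEquivFinsupp {d : Fin 3 →₀ ℕ | d.degree = k}).finrank_eq]
  have hset : {d : Fin 3 →₀ ℕ | d.degree = k} =
      ((Finset.univ : Finset (Fin 3)).finsuppAntidiag k : Set (Fin 3 →₀ ℕ)) := by
    ext d
    simp [Finsupp.degree_eq_sum]
  rw [hset, Module.finrank_finsupp_self]
  have : Fintype.card (((Finset.univ : Finset (Fin 3)).finsuppAntidiag k :
      Set (Fin 3 →₀ ℕ)) : Type) = ((Finset.univ : Finset (Fin 3)).finsuppAntidiag k).card := by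
    simp
  rw [this, Finset.card_finsuppAntidiag_nat_eq_choose]
  simp only [Finset.card_univ, Fintype.card_fin]
  rw [show 3 + k - 1 = k + 2 by omega, Nat.choose_symm_add]

theorem finrank_homPolyS2 (k : ℕ) : Module.finrank ℂ (homPolyS2 k) = (k + 2).choose 2 := by
  rw [← finrank_homogeneousSubmodule k]
  have hinj : Function.Injective (polyS2.toLinearMap.domRestrict
      (MvPolynomial.homogeneousSubmodule (Fin 3) ℂ k)) := by
    rw [← LinearMap.ker_eq_bot, LinearMap.ker_eq_bot']
    rintro ⟨p, hp⟩ h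
    ext1
    exact polyS2_injective_of_isHomogeneous ((MvPolynomial.mem_homogeneousSubmodule _ _).1 hp) h
  have := LinearMap.finrank_range_of_inj hinj
  rwa [LinearMap.range_domRestrict] at this

/-- The difference of the binomials (k+2 choose 2) and (k choose 2) is 2k + 1; this is the source of
the dimension of E_k. -/
theorem finrank_homPolyS2Prev_add (k : ℕ) :
    Module.finrank ℂ (homPolyS2Prev k) + (2 * k + 1) = Module.finrank ℂ (homPolyS2 k) := by
  match k with
  | 0 =>
    change Module.finrank ℂ (⊥ : Submodule ℂ C(S2, ℂ)) + _ = _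
    rw [finrank_bot, finrank_homPolyS2]
    rfl
  | 1 =>
    change Module.finrank ℂ (⊥ : Submodule ℂ C(S2, ℂ)) + _ = _
    rw [finrank_bot, finrank_homPolyS2]
    rfl
  | k + 2 =>
    change Module.finrank ℂ (homPolyS2 k) + _ = _
    rw [finrank_homPolyS2, finrank_homPolyS2]
    rw [Nat.choose_succ_succ (k + 3) 1, Nat.choose_succ_succ (k + 2) 1]
    simp
    ring

/-- Polynomial functions are dense among the continuous functions on the sphere. -/
theorem dense_range_polyS2 : Dense (Set.range polyS2) := by
  set A : StarSubalgebra ℂ C(S2, ℂ) :=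
    { polyS2.range with
      star_mem' := by
        rintro _ ⟨p, rfl⟩
        refine ⟨MvPolynomial.map (starRingEnd ℂ) p, ?_⟩
        ext x
        change polyS2 _ x = star (polyS2 p x)
        rw [polyS2_apply, polyS2_apply]
        simp only [polyFun, MvPolynomial.eval_map]
        rw [MvPolynomial.eval₂_eq', MvPolynomial.eval_eq']
        simp } with hA
  have hsep : A.SeparatesPoints := by
    intro x y hxy
    have : ∃ i, (x : E3) i ≠ (y : E3) i := by
      by_contra! h
      exact hxy (Subtype.ext (by ext i; exact h i))
    obtain ⟨i, hi⟩ := this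
    refine ⟨polyS2 (MvPolynomial.X i), ⟨_, ⟨MvPolynomial.X i, rfl⟩, rfl⟩, ?_⟩
    simpa [polyS2_apply, polyFun] using hi
  have h := ContinuousMap.starSubalgebra_topologicalClosure_eq_top_of_separatesPoints A hsep
  rw [dense_iff_closure_eq]
  have h2 : (A.topologicalClosure : Set C(S2, ℂ)) = closure (A : Set C(S2, ℂ)) := rfl
  rw [h] at h2
  have h3 : (A : Set C(S2, ℂ)) = Set.range polyS2 := by
    ext f
    rfl
  rw [← h3, ← h2]
  rfl

theorem polyS2_mem_iSup (p : MvPolynomial (Fin 3) ℂ) : polyS2 p ∈ ⨆ k, homPolyS2 k := by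
  rw [← MvPolynomial.sum_homogeneousComponent p, map_sum]
  exact Submodule.sum_mem _ fun k _ => Submodule.mem_iSup_of_mem k
    (polyS2_mem (MvPolynomial.homogeneousComponent_isHomogeneous k p))

/-! ### The eigenspaces inside L² and their dimension. -/

/-- The embedding of the continuous functions on the sphere into `L²`. -/
noncomputable def toL2 : C(S2, ℂ) →ₗ[ℂ] Lp ℂ 2 volS2 :=
  (ContinuousMap.toLp 2 volS2 ℂ : C(S2, ℂ) →L[ℂ] Lp ℂ 2 volS2).toLinearMap

theorem continuous_toL2 : Continuous toL2 :=
  (ContinuousMap.toLp 2 volS2 ℂ : C(S2, ℂ) →L[ℂ] Lp ℂ 2 volS2).continuous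

theorem toL2_injective : Function.Injective toL2 :=
  ContinuousMap.toLp_injective volS2

theorem inner_toL2 (f g : C(S2, ℂ)) :
    inner ℂ (toL2 f) (toL2 g) = ∫ x, starRingEnd ℂ (f x) * g x ∂volS2 := by
  refine (ContinuousMap.inner_toLp volS2 f g).trans ?_
  simp_rw [mul_comm]

theorem radialExtension_conj (f : S2 → ℂ) :
    radialExtension (fun x => starRingEnd ℂ (f x)) = Complex.conjCLE ∘ radialExtension f := by
  funext x
  by_cases hx : x = 0 <;> simp [radialExtension, hx]

theorem IsSmoothS2.conj {f : S2 → ℂ} (hf : IsSmoothS2 f) :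
    IsSmoothS2 fun x => starRingEnd ℂ (f x) := by
  rw [IsSmoothS2, radialExtension_conj]
  exact Complex.conjCLE.contDiff.comp_contDiffOn hf

theorem laplaceS2_conj {f : S2 → ℂ} (hf : IsSmoothS2 f) (x : S2) :
    laplaceS2 (fun x => starRingEnd ℂ (f x)) x = starRingEnd ℂ (laplaceS2 f x) := by
  rw [laplaceS2, radialExtension_conj]
  exact (hf.contDiffAt x).laplacian_CLM_comp_left (l := (Complex.conjCLE : ℂ →L[ℝ] ℂ))

theorem integrable_continuousMap (f : C(S2, ℂ)) : Integrable f volS2 :=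
  f.continuous.integrable_of_hasCompactSupport (HasCompactSupport.of_compactSpace _)

/-- Green's formula in terms of `L²` inner products, for functions whose Laplacians are the
continuous functions `f'` and `g'`. -/
theorem inner_toL2_laplaceS2 {f g f' g' : C(S2, ℂ)} (hf : IsSmoothS2 f) (hg : IsSmoothS2 g)
    (hf' : ∀ x, laplaceS2 f x = f' x) (hg' : ∀ x, laplaceS2 g x = g' x) :
    inner ℂ (toL2 f') (toL2 g) = inner ℂ (toL2 f) (toL2 g') := by
  rw [inner_toL2, inner_toL2, ← sub_eq_zero,
    ← integral_sub (integrable_conj_mul _ _) (integrable_conj_mul _ _)]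
  rw [← integral_mul_laplaceS2_comm hf.conj hg]
  refine integral_congr_ae (Filter.Eventually.of_forall fun x => ?_)
  simp only [laplaceS2_conj hf, hf', hg']
  ring

/-- The Laplacian is symmetric, and k(k + 1) determines k. -/
theorem toL2_orthogonal_of_ne {k l : ℕ} (hkl : k ≠ l) {f g : C(S2, ℂ)}
    (hf : f ∈ sphericalHarmonics k) (hg : g ∈ sphericalHarmonics l) :
    inner ℂ (toL2 f) (toL2 g) = 0 := by
  have h := inner_toL2_laplaceS2 (f := f) (g := g) (f' := (-((k : ℂ) * (k + 1))) • f)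
    (g' := (-((l : ℂ) * (l + 1))) • g) hf.1 hg.1
    (fun x => by have := hf.2 x; simp; linear_combination this)
    (fun x => by have := hg.2 x; simp; linear_combination this)
  rw [map_smul, map_smul, inner_smul_left, inner_smul_right] at h
  have h2 : ((l : ℂ) * (l + 1) - k * (k + 1)) * inner ℂ (toL2 f) (toL2 g) = 0 := by
    simp at h
    rcases h with h | h <;> rw [h] <;> ring
  refine (mul_eq_zero.1 h2).resolve_left fun h3 => hkl ?_
  have h4 : l * (l + 1) = k * (k + 1) := by
    have := sub_eq_zero.1 h3
    exact_mod_cast this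
  nlinarith [sq_nonneg ((k : ℤ) - l), lt_trichotomy k l]

/-- The orthogonal complement of `homPolyS2Prev k` in `homPolyS2 k`, inside `L²`. -/
noncomputable def harmonicL2 (k : ℕ) : Submodule ℂ (Lp ℂ 2 volS2) :=
  ((homPolyS2Prev k).map toL2)ᗮ ⊓ (homPolyS2 k).map toL2

instance (k : ℕ) : FiniteDimensional ℂ ((homPolyS2 k).map toL2) := Module.Finite.map _ _

instance (k : ℕ) : FiniteDimensional ℂ ((homPolyS2Prev k).map toL2) :=
  Submodule.finiteDimensional_of_le (Submodule.map_mono (homPolyS2Prev_le k))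

instance (k : ℕ) : FiniteDimensional ℂ (harmonicL2 k) :=
  Submodule.finiteDimensional_of_le inf_le_right

theorem finrank_map_toL2 (K : Submodule ℂ C(S2, ℂ)) :
    Module.finrank ℂ (K.map toL2) = Module.finrank ℂ K :=
  (Submodule.equivMapOfInjective toL2 toL2_injective K).finrank_eq.symm

theorem finrank_harmonicL2 (k : ℕ) : Module.finrank ℂ (harmonicL2 k) = 2 * k + 1 := by
  refine Submodule.finrank_add_inf_finrank_orthogonal'
    (Submodule.map_mono (homPolyS2Prev_le k)) ?_
  rw [finrank_map_toL2, finrank_map_toL2, finrank_homPolyS2Prev_add]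

/-- Put h = (Δ + k(k + 1)) f, an element of `homPolyS2Prev k`. As f is orthogonal to h and to Δh,
symmetry gives ⟨h, h⟩ = ⟨h, Δf⟩ = ⟨Δh, f⟩ = 0, so f is an eigenfunction. -/
theorem harmonicL2_le (k : ℕ) : harmonicL2 k ≤ (sphericalHarmonics k).map toL2 := by
  rintro u ⟨hu, f, hf, rfl⟩
  refine ⟨f, ⟨isSmoothS2_of_mem_homPolyS2 hf, ?_⟩, rfl⟩
  obtain ⟨h, hh, hfh⟩ := exists_laplaceS2_add_mem_prev hf
  obtain ⟨h', hh', hhh⟩ := exists_laplaceS2_prev hh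
  have hperp : ∀ v ∈ homPolyS2Prev k, inner ℂ (toL2 v) (toL2 f) = 0 := fun v hv =>
    (Submodule.mem_orthogonal _ _).1 hu _ (Submodule.mem_map_of_mem hv)
  have hgreen := inner_toL2_laplaceS2 (f := h) (g := f) (f' := h')
    (g' := h - ((k : ℂ) * (k + 1)) • f)
    (isSmoothS2_of_mem_homPolyS2 (homPolyS2Prev_le k hh)) (isSmoothS2_of_mem_homPolyS2 hf) hhh
    (fun x => by simp [← hfh x])
  rw [hperp h' hh', map_sub, map_smul, inner_sub_right, inner_smul_right, hperp h hh, mul_zero,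
    sub_zero] at hgreen
  have h0 : toL2 h = 0 := inner_self_eq_zero.1 hgreen.symm
  have h1 : h = 0 := toL2_injective (by rw [h0, map_zero])
  intro x
  rw [hfh, h1]
  rfl

/-- Induction in steps of two: degree k is the orthogonal sum of degree k - 2 and `harmonicL2 k`. -/
theorem map_homPolyS2_le_of_harmonicL2_le {K : Submodule ℂ (Lp ℂ 2 volS2)}
    (hK : ∀ k, harmonicL2 k ≤ K) (k : ℕ) : (homPolyS2 k).map toL2 ≤ K := by
  induction k using Nat.strong_induction_on with
  | _ k ih =>
    have hsup := Submodule.sup_orthogonal_inf_of_hasOrthogonalProjection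
      (Submodule.map_mono (f := toL2) (homPolyS2Prev_le k))
    rw [← hsup]
    refine sup_le ?_ (hK k)
    match k with
    | 0 => simp [homPolyS2Prev]
    | 1 => simp [homPolyS2Prev]
    | k + 2 => exact ih k (by omega)

/-- The spaces `harmonicL2 k` generate all polynomial functions, which are uniformly dense; hence f
is orthogonal to every continuous function, itself included. -/
theorem eq_zero_of_orthogonal_harmonicL2 {f : C(S2, ℂ)}
    (hf : ∀ k, ∀ u ∈ harmonicL2 k, inner ℂ u (toL2 f) = 0) : f = 0 := by
  have h1 : ∀ k, (homPolyS2 k).map toL2 ≤ (ℂ ∙ toL2 f)ᗮ :=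
    map_homPolyS2_le_of_harmonicL2_le fun k u hu =>
      Submodule.mem_orthogonal_singleton_iff_inner_left.2 (hf k u hu)
  have h2 : ∀ g : C(S2, ℂ), inner ℂ (toL2 g) (toL2 f) = 0 := by
    intro g
    have hcl : IsClosed {g : C(S2, ℂ) | inner ℂ (toL2 g) (toL2 f) = 0} :=
      isClosed_eq (continuous_toL2.inner continuous_const) continuous_const
    refine hcl.closure_subset_iff.2 ?_ (dense_range_polyS2 g)
    rintro _ ⟨p, rfl⟩
    have hle : (⨆ k, homPolyS2 k) ≤ ((ℂ ∙ toL2 f)ᗮ).comap toL2 :=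
      iSup_le fun k => Submodule.map_le_iff_le_comap.1 (h1 k)
    exact Submodule.mem_orthogonal_singleton_iff_inner_left.1 (hle (polyS2_mem_iSup p))
  exact toL2_injective (by rw [map_zero]; exact inner_self_eq_zero.1 (h2 f))

/-- Subtract from an eigenfunction its projection to `harmonicL2 l`. The remainder is orthogonal to
`harmonicL2 l` by construction and to every other `harmonicL2 k` because the eigenvalues differ, so
it is zero. -/
theorem map_sphericalHarmonics (l : ℕ) : (sphericalHarmonics l).map toL2 = harmonicL2 l := by
  refine le_antisymm ?_ (harmonicL2_le l)
  rintro _ ⟨f, hf, rfl⟩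
  set u := (harmonicL2 l).starProjection (toL2 f) with hu
  have hul : u ∈ harmonicL2 l := Submodule.starProjection_apply_mem _ _
  obtain ⟨g, hg, hgu⟩ := harmonicL2_le l hul
  have hfg : f - g = 0 := by
    refine eq_zero_of_orthogonal_harmonicL2 fun k v hv => ?_
    by_cases hkl : k = l
    · subst hkl
      rw [map_sub, hgu]
      exact (Submodule.mem_orthogonal _ _).1
        (Submodule.sub_starProjection_mem_orthogonal (K := harmonicL2 k) (toL2 f)) v hv
    · obtain ⟨w, hw, rfl⟩ := harmonicL2_le k hv
      exact toL2_orthogonal_of_ne hkl hw (Submodule.sub_mem _ hf hg)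
  rw [sub_eq_zero.1 hfg, hgu]
  exact hul

instance (l : ℕ) : Nonempty (HarmonicONB l) := by
  set b := (stdOrthonormalBasis ℂ (harmonicL2 l)).reindex (finCongr (finrank_harmonicL2 l)) with hb
  have hmem : ∀ m, ∃ f ∈ sphericalHarmonics l, toL2 f = b m := fun m =>
    harmonicL2_le l (b m).2
  choose e he heb using hmem
  have hspan : (Submodule.span ℂ (Set.range e)).map toL2 = harmonicL2 l := by
    rw [Submodule.map_span, ← Set.range_comp]
    have h1 : Set.range (toL2 ∘ e) = (harmonicL2 l).subtype '' Set.range b := by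
      rw [← Set.range_comp]
      congr 1
      funext m
      simp [heb]
    have h2 : Submodule.span ℂ (Set.range b) = ⊤ := by
      have := b.toBasis.span_eq
      simpa using this
    rw [h1, ← Submodule.map_span, h2, Submodule.map_subtype_top]
  refine ⟨⟨e, ?_, fun m n => ?_⟩⟩
  · refine Submodule.map_injective_of_injective toL2_injective ?_
    rw [hspan, map_sphericalHarmonics]
  · rw [← inner_toL2, heb, heb, ← Submodule.coe_inner, orthonormal_iff_ite.1 b.orthonormal]

/-! ### Rotations, the addition theorem and the local Weyl law. -/

theorem IsSmoothS2.comp_rot {f : S2 → ℂ} (hf : IsSmoothS2 f) (R : E3 ≃ₗᵢ[ℝ] E3) :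
    IsSmoothS2 fun x => f (rotS2 R x) := by
  rw [IsSmoothS2, radialExtension_comp_rot]
  exact ContDiffOn.comp hf R.contDiff.contDiffOn fun x hx => by simpa using hx

/-- The Euclidean Laplacian may be computed in any orthonormal basis; the standard basis on one side
and its image under R on the other match term by term. -/
theorem laplaceS2_comp_rot {f : S2 → ℂ} (R : E3 ≃ₗᵢ[ℝ] E3) (x : S2) :
    laplaceS2 (fun x => f (rotS2 R x)) x = laplaceS2 f (rotS2 R x) := by
  rw [laplaceS2, radialExtension_comp_rot, laplaceS2,
    InnerProductSpace.laplacian_eq_iteratedFDeriv_orthonormalBasis _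
      (EuclideanSpace.basisFun (Fin 3) ℝ),
    InnerProductSpace.laplacian_eq_iteratedFDeriv_orthonormalBasis _
      ((EuclideanSpace.basisFun (Fin 3) ℝ).map R)]
  refine Finset.sum_congr rfl fun i _ => ?_
  have h := R.toContinuousLinearEquiv.iteratedFDerivWithin_comp_right (radialExtension f)
    (s := Set.univ) uniqueDiffOn_univ (x := (x : E3)) (Set.mem_univ _) 2
  have h2 : (radialExtension f ∘ R.toContinuousLinearEquiv) =
    fun y => radialExtension f (R y) := rfl
  rw [h2, Set.preimage_univ, iteratedFDerivWithin_univ, iteratedFDerivWithin_univ] at h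
  rw [h]
  simp only [ContinuousMultilinearMap.compContinuousLinearMap_apply]
  congr 1
  funext j
  fin_cases j <;> rfl

theorem comp_rot_mem_sphericalHarmonics {l : ℕ} {f : C(S2, ℂ)} (hf : f ∈ sphericalHarmonics l)
    (R : E3 ≃ₗᵢ[ℝ] E3) : f.comp (rotS2 R) ∈ sphericalHarmonics l := by
  refine ⟨hf.1.comp_rot R, fun x => ?_⟩
  have h := hf.2 (rotS2 R x)
  rw [← laplaceS2_comp_rot] at h
  exact h

theorem exists_rotS2_eq (x y : S2) : ∃ R : E3 ≃ₗᵢ[ℝ] E3, rotS2 R x = y := by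
  refine ⟨(ℝ ∙ ((x : E3) - y))ᗮ.reflection, Subtype.ext ?_⟩
  exact Submodule.reflection_sub (by rw [S2.norm_eq, S2.norm_eq])

/-- The sum of squares of an orthonormal system inside the span of an orthonormal basis of the same
size does not depend on the system. -/
theorem sum_norm_sq_eq_of_orthonormal {l : ℕ} {e e' : Fin (2 * l + 1) → C(S2, ℂ)}
    (he : IsHarmonicONB l e) (hmem : ∀ m, e' m ∈ sphericalHarmonics l)
    (he' : ∀ m n, ∫ x, starRingEnd ℂ (e' m x) * e' n x ∂volS2 = if m = n then 1 else 0) (x : S2) :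
    ∑ m, ‖e' m x‖ ^ 2 = ∑ m, ‖e m x‖ ^ 2 := by
  have hcoef : ∀ m, ∃ c : Fin (2 * l + 1) → ℂ, ∑ j, c j • e j = e' m := fun m =>
    (Submodule.mem_span_range_iff_exists_fun ℂ).1 (he.1 ▸ hmem m)
  choose c hc using hcoef
  set A : Matrix (Fin (2 * l + 1)) (Fin (2 * l + 1)) ℂ := fun j m => c m j with hA
  have hval : ∀ m y, e' m y = ∑ j, A j m * e j y := by
    intro m y
    rw [← hc m]
    simp [ContinuousMap.sum_apply, hA]
  have hAA : A.conjTranspose * A = 1 := by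
    ext m n
    have h1 := he' m n
    have h2 : ∀ y, starRingEnd ℂ (e' m y) * e' n y =
        ∑ i, ∑ j, (starRingEnd ℂ (A i m) * A j n) * (starRingEnd ℂ (e i y) * e j y) := by
      intro y
      simp only [hval, map_sum, map_mul, Finset.sum_mul_sum]
      refine Finset.sum_congr rfl fun i _ => Finset.sum_congr rfl fun j _ => ?_
      ring
    simp only [h2] at h1
    rw [integral_finsetSum _ fun i _ => integrable_finsetSum _ fun j _ =>
      (integrable_conj_mul (e i) (e j)).const_mul _] at h1
    have h3 : ∀ i, ∫ y, ∑ j, (starRingEnd ℂ (A i m) * A j n) *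
        (starRingEnd ℂ (e i y) * e j y) ∂volS2 = starRingEnd ℂ (A i m) * A i n := by
      intro i
      rw [integral_finsetSum _ fun j _ => (integrable_conj_mul (e i) (e j)).const_mul _]
      simp only [integral_const_mul, he.2]
      simp
    simp only [h3] at h1
    rw [Matrix.mul_apply, Matrix.one_apply]
    simpa [Matrix.conjTranspose_apply] using h1
  -- Orthonormality of the system says that the columns of A are orthonormal; the sum over m needs
  -- the rows, and A is square.
  have hAA' : A * A.conjTranspose = 1 := mul_eq_one_comm.1 hAA
  have hentry : ∀ j k, ∑ m, A j m * starRingEnd ℂ (A k m) = if j = k then 1 else 0 := by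
    intro j k
    have := congrFun (congrFun hAA' j) k
    rw [Matrix.mul_apply, Matrix.one_apply] at this
    simpa [Matrix.conjTranspose_apply] using this
  have hcx : ∑ m, (starRingEnd ℂ (e' m x) * e' m x) = ∑ m, starRingEnd ℂ (e m x) * e m x := by
    calc ∑ m, (starRingEnd ℂ (e' m x) * e' m x)
        = ∑ m, ∑ k, ∑ j, (A j m * starRingEnd ℂ (A k m)) * (starRingEnd ℂ (e k x) * e j x) := by
          refine Finset.sum_congr rfl fun m _ => ?_
          simp only [hval, map_sum, map_mul, Finset.sum_mul_sum]
          refine Finset.sum_congr rfl fun i _ => Finset.sum_congr rfl fun j _ => ?_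
          ring
      _ = ∑ k, ∑ j, (∑ m, A j m * starRingEnd ℂ (A k m)) * (starRingEnd ℂ (e k x) * e j x) := by
          rw [Finset.sum_comm]
          refine Finset.sum_congr rfl fun k _ => ?_
          rw [Finset.sum_comm]
          refine Finset.sum_congr rfl fun j _ => ?_
          rw [Finset.sum_mul]
      _ = _ := by
          simp [hentry]
  simp only [Complex.conj_mul'] at hcx
  exact_mod_cast hcx

theorem IsHarmonicONB.mem {l : ℕ} {e : Fin (2 * l + 1) → C(S2, ℂ)} (he : IsHarmonicONB l e)
    (m : Fin (2 * l + 1)) : e m ∈ sphericalHarmonics l := by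
  rw [← he.1]
  exact Submodule.subset_span (Set.mem_range_self m)

theorem integrable_mul_norm_sq (a f : C(S2, ℂ)) :
    Integrable (fun x => a x * ((‖f x‖ ^ 2 : ℝ) : ℂ)) volS2 :=
  Continuous.integrable_of_hasCompactSupport (by fun_prop) (HasCompactSupport.of_compactSpace _)

theorem IsHarmonicONB.integral_norm_sq {l : ℕ} {e : Fin (2 * l + 1) → C(S2, ℂ)}
    (he : IsHarmonicONB l e) (m : Fin (2 * l + 1)) :
    ∫ x, ((‖e m x‖ ^ 2 : ℝ) : ℂ) ∂volS2 = 1 := by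
  have := he.2 m m
  simpa [Complex.conj_mul'] using this

/-- The addition theorem for spherical harmonics: the sum of squares of an orthonormal basis is
constant on the sphere. -/
theorem IsHarmonicONB.sum_norm_sq_eq {l : ℕ} {e : Fin (2 * l + 1) → C(S2, ℂ)}
    (he : IsHarmonicONB l e) (x y : S2) : ∑ m, ‖e m x‖ ^ 2 = ∑ m, ‖e m y‖ ^ 2 := by
  obtain ⟨R, rfl⟩ := exists_rotS2_eq x y
  refine (sum_norm_sq_eq_of_orthonormal he (e' := fun m => (e m).comp (rotS2 R))
    (fun m => comp_rot_mem_sphericalHarmonics (he.mem m) R) (fun m n => ?_) x).symm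
  rw [← he.2 m n]
  exact integral_comp_rot (fun x => starRingEnd ℂ (e m x) * e n x) R

instance : Nonempty S2 := (NormedSpace.sphere_nonempty.2 zero_le_one).to_subtype

/-- The local Weyl law on the sphere. -/
theorem IsHarmonicONB.sum_integral_eq {l : ℕ} {e : Fin (2 * l + 1) → C(S2, ℂ)}
    (he : IsHarmonicONB l e) (a : C(S2, ℂ)) :
    ∑ m, ∫ x, a x * ((‖e m x‖ ^ 2 : ℝ) : ℂ) ∂volS2 = (2 * l + 1 : ℕ) * ⨍ x, a x ∂volS2 := by
  obtain ⟨y⟩ := (inferInstance : Nonempty S2)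
  set κ : ℝ := ∑ m, ‖e m y‖ ^ 2 with hκ
  have hsum : ∀ a : C(S2, ℂ), ∑ m, ∫ x, a x * ((‖e m x‖ ^ 2 : ℝ) : ℂ) ∂volS2 =
      κ * ∫ x, a x ∂volS2 := by
    intro a
    rw [← integral_finsetSum _ fun m _ => integrable_mul_norm_sq a (e m), ← integral_const_mul]
    refine integral_congr_ae (Filter.Eventually.of_forall fun x => ?_)
    simp only
    rw [← Finset.mul_sum, ← Complex.ofReal_sum, he.sum_norm_sq_eq x y, ← hκ, mul_comm]
  -- The constant observable 1 identifies κ as (2l + 1) divided by the total mass.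
  have h1 := hsum 1
  simp only [ContinuousMap.one_apply, one_mul, he.integral_norm_sq] at h1
  rw [hsum, average_eq]
  have hv : volS2.real Set.univ ≠ 0 := by
    simp [Measure.real, ENNReal.toReal_eq_zero_iff, Real.pi_pos]
  have hv' : (volS2.real Set.univ : ℂ) ≠ 0 := by exact_mod_cast hv
  simp at h1
  have h2 : (κ : ℂ) = (2 * l + 1) / (volS2.real Set.univ : ℂ) := by
    rw [eq_div_iff hv']
    simpa using h1.symm
  rw [h2]
  simp
  ring

/-! ### Gaussian integrals over complex vectors. -/

section ComplexGaussian

open scoped Matrix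

variable {ι : Type*} [Fintype ι]

/-- The squared Euclidean norm of a complex vector. -/
noncomputable def normSqSum (v : ι → ℂ) : ℝ := ∑ i, ‖v i‖ ^ 2

theorem normSqSum_nonneg (v : ι → ℂ) : 0 ≤ normSqSum v :=
  Finset.sum_nonneg fun _ _ => sq_nonneg _

theorem continuous_normSqSum : Continuous (normSqSum : (ι → ℂ) → ℝ) := by
  unfold normSqSum
  fun_prop

theorem star_dotProduct_self_eq (v : ι → ℂ) : star v ⬝ᵥ v = (normSqSum v : ℂ) := by
  simp [dotProduct, normSqSum, Complex.conj_mul']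

theorem normSqSum_smul (c : ℝ) (v : ι → ℂ) : normSqSum (c • v) = c ^ 2 * normSqSum v := by
  simp [normSqSum, mul_pow, Finset.mul_sum]

theorem normSqSum_eq_zero {v : ι → ℂ} (h : normSqSum v = 0) : v = 0 := by
  funext i
  have := (Finset.sum_eq_zero_iff_of_nonneg fun i _ => sq_nonneg ‖v i‖).1 h i (Finset.mem_univ i)
  simpa using this

theorem star_mulVec_dotProduct (U : Matrix ι ι ℂ) (A : Matrix ι ι ℂ) (v : ι → ℂ) :
    star (U *ᵥ v) ⬝ᵥ (A *ᵥ (U *ᵥ v)) = star v ⬝ᵥ ((Uᴴ * A * U) *ᵥ v) := by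
  rw [Matrix.star_mulVec, ← Matrix.mulVec_mulVec, ← Matrix.mulVec_mulVec,
    Matrix.dotProduct_mulVec (star v) Uᴴ]

theorem lintegral_gaussian_diagonal {c : ι → ℝ} (hc : ∀ i, c i < 1) :
    ∫⁻ v : ι → ℂ, ENNReal.ofReal (Real.exp (-normSqSum v + ∑ i, c i * ‖v i‖ ^ 2)) =
      ENNReal.ofReal (∏ i, Real.pi / (1 - c i)) := by
  have hfun : ∀ v : ι → ℂ, Real.exp (-normSqSum v + ∑ i, c i * ‖v i‖ ^ 2) =
      ∏ i, Real.exp (-(1 - c i) * ‖v i‖ ^ 2) := by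
    intro v
    rw [← Real.exp_sum, normSqSum, ← Finset.sum_neg_distrib, ← Finset.sum_add_distrib]
    congr 1
    refine Finset.sum_congr rfl fun i _ => ?_
    ring
  have hone : ∀ i, ∫ z : ℂ, Real.exp (-(1 - c i) * ‖z‖ ^ 2) = Real.pi / (1 - c i) := by
    intro i
    have := GaussianFourier.integral_rexp_neg_mul_sq_norm (V := ℂ) (sub_pos.2 (hc i))
    rw [this, Complex.finrank_real_complex]
    norm_num
  have hpos : ∀ i, 0 < Real.pi / (1 - c i) := fun i => div_pos Real.pi_pos (sub_pos.2 (hc i))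
  -- A non-integrable function has integral 0 by convention, whereas this integral is positive.
  have hint : ∀ i, Integrable fun z : ℂ => Real.exp (-(1 - c i) * ‖z‖ ^ 2) := by
    intro i
    by_contra h
    have := hone i
    rw [integral_undef h] at this
    exact (hpos i).ne this
  simp only [hfun]
  rw [← ofReal_integral_eq_lintegral_ofReal]
  · congr 1
    rw [integral_fintype_prod_volume_eq_prod
      (fun i (z : ℂ) => Real.exp (-(1 - c i) * ‖z‖ ^ 2))]
    simp only [hone]
  · exact Integrable.fintype_prod hint
  · exact Filter.Eventually.of_forall fun v => Finset.prod_nonneg fun i _ => (Real.exp_pos _).le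

variable [DecidableEq ι]

theorem normSqSum_unitary_mulVec {U : Matrix ι ι ℂ} (hU : U ∈ Matrix.unitaryGroup ι ℂ)
    (v : ι → ℂ) : normSqSum (U *ᵥ v) = normSqSum v := by
  have h := star_mulVec_dotProduct U 1 v
  have hU' : Uᴴ * U = 1 := Matrix.mem_unitaryGroup_iff'.1 hU
  rw [Matrix.one_mulVec, Matrix.mul_one, hU', Matrix.one_mulVec, star_dotProduct_self_eq,
    star_dotProduct_self_eq] at h
  exact_mod_cast h

/-- An invertible linear map multiplies Lebesgue measure by a constant. The Euclidean unit ball is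
preserved and has finite positive measure, so the constant is 1. -/
theorem measurePreserving_unitary_mulVec {U : Matrix ι ι ℂ} (hU : U ∈ Matrix.unitaryGroup ι ℂ) :
    MeasurePreserving (fun v : ι → ℂ => U *ᵥ v) volume volume := by
  have hUU : U * Uᴴ = 1 := Matrix.mem_unitaryGroup_iff.1 hU
  have hUU' : Uᴴ * U = 1 := Matrix.mem_unitaryGroup_iff'.1 hU
  set f : (ι → ℂ) →ₗ[ℝ] (ι → ℂ) := (Matrix.mulVecLin U).restrictScalars ℝ with hf
  set g : (ι → ℂ) →ₗ[ℝ] (ι → ℂ) := (Matrix.mulVecLin Uᴴ).restrictScalars ℝ with hg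
  have hfg : f ∘ₗ g = LinearMap.id := by
    refine LinearMap.ext fun v => ?_
    simp [hf, hg, Matrix.mulVec_mulVec, hUU]
  have hdet : LinearMap.det f ≠ 0 := by
    intro h
    have := congrArg LinearMap.det hfg
    rw [LinearMap.det_comp, h, zero_mul, LinearMap.det_id] at this
    exact zero_ne_one this
  have hcont : Continuous f := f.continuous_of_finiteDimensional
  refine ⟨hcont.measurable, ?_⟩
  have hmap := Measure.map_linearMap_addHaar_eq_smul_addHaar (volume : Measure (ι → ℂ)) hdet
  set B : Set (ι → ℂ) := {v | normSqSum v < 1} with hB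
  have hBo : IsOpen B := isOpen_lt continuous_normSqSum continuous_const
  have hBpos : volume B ≠ 0 := (hBo.measure_pos _ ⟨0, by simp [hB, normSqSum]⟩).ne'
  have hBfin : volume B ≠ ⊤ := by
    refine (lt_of_le_of_lt (measure_mono ?_) (measure_closedBall_lt_top (x := (0 : ι → ℂ))
      (r := 1))).ne
    intro v hv
    rw [mem_closedBall_zero_iff, pi_norm_le_iff_of_nonneg zero_le_one]
    intro i
    have h1 : ‖v i‖ ^ 2 ≤ normSqSum v :=
      Finset.single_le_sum (f := fun i => ‖v i‖ ^ 2) (fun i _ => sq_nonneg _) (Finset.mem_univ i)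
    have h2 : normSqSum v < 1 := hv
    have h3 := norm_nonneg (v i)
    nlinarith
  have h1 : Measure.map f volume B = volume B := by
    rw [Measure.map_apply hcont.measurable hBo.measurableSet]
    congr 1
    ext v
    exact iff_of_eq (congrArg (· < (1 : ℝ)) (normSqSum_unitary_mulVec hU v))
  rw [hmap, Measure.smul_apply, smul_eq_mul] at h1
  have h2 : ENNReal.ofReal |(LinearMap.det f)⁻¹| = 1 := by
    have := (ENNReal.mul_eq_right hBpos hBfin).1 h1
    exact this
  rw [h2, one_smul] at hmap
  exact hmap

/-- A unitary change of variables to an eigenbasis reduces this to the diagonal case. -/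
theorem lintegral_gaussian_hermitian {H : Matrix ι ι ℂ} (hH : H.IsHermitian) {t : ℝ}
    (ht : ∀ i, t * hH.eigenvalues i < 1) :
    ∫⁻ v : ι → ℂ, ENNReal.ofReal (Real.exp (-normSqSum v + t * (star v ⬝ᵥ (H *ᵥ v)).re)) =
      ENNReal.ofReal (∏ i, Real.pi / (1 - t * hH.eigenvalues i)) := by
  rw [← lintegral_gaussian_diagonal ht]
  set V : Matrix ι ι ℂ := hH.eigenvectorUnitary.1 with hV
  have hVU : V ∈ Matrix.unitaryGroup ι ℂ := hH.eigenvectorUnitary.2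
  have hdiag : Vᴴ * H * V = Matrix.diagonal (RCLike.ofReal ∘ hH.eigenvalues) := by
    rw [← hH.conjStarAlgAut_star_eigenvectorUnitary, Unitary.conjStarAlgAut_star_apply]
    rfl
  have hmeas : Measurable fun v : ι → ℂ =>
      ENNReal.ofReal (Real.exp (-normSqSum v + t * (star v ⬝ᵥ (H *ᵥ v)).re)) := by
    have := continuous_normSqSum (ι := ι)
    refine Measurable.ennreal_ofReal (Continuous.measurable ?_)
    simp only [dotProduct, Matrix.mulVec]
    fun_prop
  rw [← (measurePreserving_unitary_mulVec hVU).lintegral_comp hmeas]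
  refine lintegral_congr fun v => ?_
  rw [normSqSum_unitary_mulVec hVU, star_mulVec_dotProduct, hdiag]
  simp [dotProduct, Finset.mul_sum, Matrix.mulVec_diagonal]
  congr 3
  refine Finset.sum_congr rfl fun i _ => ?_
  rw [← Complex.normSq_eq_norm_sq, Complex.normSq_apply]
  ring

/-- Complete the normalised v to an orthonormal basis and take its members as columns. -/
theorem exists_unitary_mulVec_single (m : ι) (v : ι → ℂ) :
    ∃ W ∈ Matrix.unitaryGroup ι ℂ, W *ᵥ (Real.sqrt (normSqSum v) • Pi.single m 1) = v := by
  by_cases hv : normSqSum v = 0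
  · refine ⟨1, one_mem _, ?_⟩
    rw [normSqSum_eq_zero hv]
    simp [normSqSum]
  have hpos : 0 < Real.sqrt (normSqSum v) :=
    Real.sqrt_pos.2 (lt_of_le_of_ne (normSqSum_nonneg v) (Ne.symm hv))
  set r := Real.sqrt (normSqSum v) with hr
  set w : EuclideanSpace ℂ ι := WithLp.toLp 2 (r⁻¹ • v) with hw
  have hw1 : ‖w‖ = 1 := by
    rw [EuclideanSpace.norm_eq]
    have : ∑ i, ‖w i‖ ^ 2 = normSqSum (r⁻¹ • v) := rfl
    rw [this, normSqSum_smul, inv_pow, hr, Real.sq_sqrt (normSqSum_nonneg v),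
      inv_mul_cancel₀ hv, Real.sqrt_one]
  have horth : Orthonormal ℂ (({m} : Set ι).domRestrict fun _ : ι => w) := by
    refine ⟨fun _ => hw1, fun i j hij => absurd (Subsingleton.elim i j) hij⟩
  obtain ⟨b, hb⟩ := horth.exists_orthonormalBasis_extension_of_card_eq finrank_euclideanSpace
  refine ⟨_, (EuclideanSpace.basisFun ι ℂ).toMatrix_orthonormalBasis_mem_unitary b, ?_⟩
  rw [Matrix.mulVec_smul, Matrix.mulVec_single_one]
  have hcol : ((EuclideanSpace.basisFun ι ℂ).toBasis.toMatrix b).col m = r⁻¹ • v := by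
    funext i
    have := hb m rfl
    simp [Matrix.col, Module.Basis.toMatrix_apply, this, hw]
  rw [hcol, smul_smul, mul_inv_cancel₀ hpos.ne', one_smul]

end ComplexGaussian

/-! ### Concentration for a column of a Haar unitary. -/

section HaarConcentration

open scoped Matrix

variable {l : ℕ}

instance (l : ℕ) : SecondCountableTopology (UnitaryS2 l) :=
  inferInstanceAs (SecondCountableTopology
    {U : Fin (2 * l + 1) → Fin (2 * l + 1) → ℂ // (U : Matrix _ _ ℂ) ∈
      Matrix.unitaryGroup (Fin (2 * l + 1)) ℂ})

instance (l : ℕ) : (haarUnitary l).IsMulLeftInvariant := by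
  unfold haarUnitary
  infer_instance

instance (l : ℕ) : (haarUnitary l).IsHaarMeasure := by
  unfold haarUnitary
  infer_instance

/-- A right translate of Haar measure is again a left-invariant probability measure, so uniqueness
applies. -/
theorem map_mul_right_haarUnitary (W : UnitaryS2 l) :
    (haarUnitary l).map (· * W) = haarUnitary l := by
  have : IsProbabilityMeasure ((haarUnitary l).map (· * W)) :=
    Measure.isProbabilityMeasure_map (continuous_mul_const W).measurable.aemeasurable
  exact Measure.isHaarMeasure_eq_of_isProbabilityMeasure _ _

theorem lintegral_haarUnitary_mul_right (W : UnitaryS2 l) {f : UnitaryS2 l → ENNReal}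
    (hf : Measurable f) : ∫⁻ U, f (U * W) ∂haarUnitary l = ∫⁻ U, f U ∂haarUnitary l := by
  conv_rhs => rw [← map_mul_right_haarUnitary W]
  rw [lintegral_map hf (continuous_mul_const W).measurable]

theorem continuous_unitary_mulVec :
    Continuous fun p : UnitaryS2 l × (Fin (2 * l + 1) → ℂ) => p.1.1 *ᵥ p.2 := by
  have h : Continuous fun p : UnitaryS2 l × (Fin (2 * l + 1) → ℂ) => p.1.1 :=
    continuous_subtype_val.comp continuous_fst
  exact h.matrix_mulVec continuous_snd

/-- Comparison of the exponential moments of a quadratic function of a column of a Haar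
unitary with its Gaussian exponential moments. -/
theorem lintegral_exp_column_le {Q : (Fin (2 * l + 1) → ℂ) → ℝ} (hQ : Continuous Q)
    (hhom : ∀ (c : ℝ) v, Q (c • v) = c ^ 2 * Q v) (m : Fin (2 * l + 1))
    (hlt : ∀ v, normSqSum v = 1 → Q v < 1) :
    (∫⁻ U : UnitaryS2 l, ENNReal.ofReal
        (Real.pi ^ (2 * l + 1) * Real.exp ((2 * l + 1 : ℕ) * Q (U.1 *ᵥ Pi.single m 1)))
        ∂haarUnitary l) ≤
      ∫⁻ v : Fin (2 * l + 1) → ℂ, ENNReal.ofReal (Real.exp (-normSqSum v + Q v)) := by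
  have hN := continuous_normSqSum (ι := Fin (2 * l + 1))
  have hsingle : normSqSum (Pi.single m 1 : Fin (2 * l + 1) → ℂ) = 1 := by
    rw [normSqSum, Finset.sum_eq_single m]
    · simp
    · intro i _ hi
      simp [hi]
    · simp
  have hcol : ∀ U : UnitaryS2 l, normSqSum (U.1 *ᵥ Pi.single m 1) = 1 := fun U => by
    rw [normSqSum_unitary_mulVec U.2, hsingle]
  have hmv := continuous_unitary_mulVec (l := l)
  have hmve : Continuous fun U : UnitaryS2 l => U.1 *ᵥ (Pi.single m 1 : Fin (2 * l + 1) → ℂ) :=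
    hmv.comp (Continuous.prodMk continuous_id continuous_const)
  calc (∫⁻ U : UnitaryS2 l, ENNReal.ofReal
        (Real.pi ^ (2 * l + 1) * Real.exp ((2 * l + 1 : ℕ) * Q (U.1 *ᵥ Pi.single m 1)))
        ∂haarUnitary l)
      ≤ ∫⁻ U : UnitaryS2 l, (∫⁻ v : Fin (2 * l + 1) → ℂ, ENNReal.ofReal
          (Real.exp (-normSqSum v + normSqSum v * Q (U.1 *ᵥ Pi.single m 1)))) ∂haarUnitary l := by
        -- With n = 2l + 1 and y < 1, the Gaussian integral equals (π / (1 - y))ⁿ, which is at least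
        -- πⁿ exp(n y) because 1 - y ≤ exp(-y).
        refine lintegral_mono fun U => ?_
        set y := Q (U.1 *ᵥ Pi.single m 1) with hy
        have hy1 : y < 1 := hlt _ (hcol U)
        have h1 := lintegral_gaussian_diagonal (ι := Fin (2 * l + 1)) (c := fun _ => y)
          fun _ => hy1
        have h2 : ∀ v : Fin (2 * l + 1) → ℂ, normSqSum v * y = ∑ i, y * ‖v i‖ ^ 2 := by
          intro v
          rw [← Finset.mul_sum, mul_comm]
          rfl
        simp only [h2]
        rw [h1]
        refine ENNReal.ofReal_le_ofReal ?_
        rw [Finset.prod_const, Finset.card_univ, Fintype.card_fin, div_pow, div_eq_mul_inv]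
        refine mul_le_mul_of_nonneg_left ?_ (by positivity)
        rw [Real.exp_nat_mul, ← inv_pow]
        refine pow_le_pow_left₀ (Real.exp_pos _).le ?_ _
        rw [le_inv_comm₀ (Real.exp_pos _) (by linarith), ← Real.exp_neg]
        linarith [Real.add_one_le_exp (-y)]
    _ = ∫⁻ v : Fin (2 * l + 1) → ℂ, ∫⁻ U : UnitaryS2 l, ENNReal.ofReal
          (Real.exp (-normSqSum v + normSqSum v * Q (U.1 *ᵥ Pi.single m 1))) ∂haarUnitary l := by
        refine lintegral_lintegral_swap (Measurable.aemeasurable ?_)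
        refine Measurable.ennreal_ofReal (Continuous.measurable ?_)
        have := hQ.comp (hmve.comp (continuous_fst (Y := Fin (2 * l + 1) → ℂ)))
        have h2 := hN.comp (continuous_snd (X := UnitaryS2 l))
        exact Real.continuous_exp.comp (h2.neg.add (h2.mul this))
    _ = ∫⁻ v : Fin (2 * l + 1) → ℂ, ∫⁻ U : UnitaryS2 l, ENNReal.ofReal
          (Real.exp (-normSqSum v + Q (U.1 *ᵥ v))) ∂haarUnitary l := by
        refine lintegral_congr fun v => ?_
        -- Since v is its length times W applied to the m-th basis vector, replacing U by U W and
        -- using homogeneity turns the exponent into Q (U v).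
        obtain ⟨W, hW, hWv⟩ := exists_unitary_mulVec_single m v
        have hmeas : Measurable fun U : UnitaryS2 l => ENNReal.ofReal
            (Real.exp (-normSqSum v + normSqSum v * Q (U.1 *ᵥ Pi.single m 1))) :=
          Measurable.ennreal_ofReal (Continuous.measurable (Real.continuous_exp.comp
            (continuous_const.add (continuous_const.mul (hQ.comp hmve)))))
        rw [← lintegral_haarUnitary_mul_right ⟨W, hW⟩ hmeas]
        refine lintegral_congr fun U => ?_
        have h1 : U.1 *ᵥ v = Real.sqrt (normSqSum v) •
            ((U * ⟨W, hW⟩ : UnitaryS2 l).1 *ᵥ Pi.single m 1) := by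
          conv_lhs => rw [← hWv]
          rw [Matrix.mulVec_mulVec, Matrix.mulVec_smul]
          rfl
        rw [h1, hhom, Real.sq_sqrt (normSqSum_nonneg v)]
    _ = ∫⁻ U : UnitaryS2 l, (∫⁻ v : Fin (2 * l + 1) → ℂ, ENNReal.ofReal
          (Real.exp (-normSqSum v + Q (U.1 *ᵥ v)))) ∂haarUnitary l := by
        refine (lintegral_lintegral_swap (Measurable.aemeasurable ?_)).symm
        refine Measurable.ennreal_ofReal (Continuous.measurable ?_)
        exact Real.continuous_exp.comp ((hN.comp continuous_snd).neg.add (hQ.comp hmv))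
    _ = ∫⁻ _ : UnitaryS2 l, (∫⁻ v : Fin (2 * l + 1) → ℂ, ENNReal.ofReal
          (Real.exp (-normSqSum v + Q v))) ∂haarUnitary l := by
        -- For fixed U, substituting U v for v removes U; the outer integral then has mass one.
        refine lintegral_congr fun U => ?_
        have hmeas : Measurable fun v : Fin (2 * l + 1) → ℂ => ENNReal.ofReal
            (Real.exp (-normSqSum v + Q v)) :=
          Measurable.ennreal_ofReal (Continuous.measurable
            (Real.continuous_exp.comp (hN.neg.add hQ)))
        rw [← (measurePreserving_unitary_mulVec U.2).lintegral_comp hmeas]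
        simp only [normSqSum_unitary_mulVec U.2]
    _ = _ := by simp

/-- The linear term is kept exact so that it cancels when summed over the eigenvalues of a traceless
matrix. -/
theorem inv_one_sub_le_exp {y : ℝ} (hy : |y| ≤ 1 / 2) : (1 - y)⁻¹ ≤ Real.exp (y + y ^ 2) := by
  obtain ⟨h1, h2⟩ := abs_le.1 hy
  rw [inv_le_iff_one_le_mul₀ (by linarith)]
  -- As (1 + y + y²)(1 - y) = 1 - y³, the first-order bound on exp suffices only for y ≤ 0; for y >
  -- 0 the quadratic one is used.
  rcases le_total y 0 with h | h
  · have h3 := Real.add_one_le_exp (y + y ^ 2)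
    calc (1 : ℝ) ≤ (y + y ^ 2 + 1) * (1 - y) := by nlinarith [sq_nonneg y]
      _ ≤ _ := mul_le_mul_of_nonneg_right h3 (by linarith)
  · have h3 := Real.quadratic_le_exp_of_nonneg (x := y + y ^ 2) (by positivity)
    have h4 : 0 ≤ (1 - y ^ 2) * (1 + y) - 2 * y := by nlinarith [sq_nonneg y]
    calc (1 : ℝ) ≤ (1 + (y + y ^ 2) + (y + y ^ 2) ^ 2 / 2) * (1 - y) := by
          nlinarith [mul_nonneg (sq_nonneg y) h4]
      _ ≤ _ := mul_le_mul_of_nonneg_right h3 (by linarith)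

/-- Concentration for quadratic forms of a column of a Haar unitary matrix. -/
theorem haarUnitary_column_tail {H : Matrix (Fin (2 * l + 1)) (Fin (2 * l + 1)) ℂ}
    (hH : H.IsHermitian) (htr : H.trace = 0) {K : ℝ} (hK : 0 < K)
    (hbd : ∀ v, |(star v ⬝ᵥ (H *ᵥ v)).re| ≤ K * normSqSum v) (m : Fin (2 * l + 1)) {s : ℝ}
    (hs0 : 0 ≤ s) (hsK : s ≤ K) :
    haarUnitary l {U : UnitaryS2 l |
        s ≤ (star (U.1 *ᵥ Pi.single m 1) ⬝ᵥ (H *ᵥ (U.1 *ᵥ Pi.single m 1))).re} ≤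
      ENNReal.ofReal (Real.exp (-((2 * l + 1 : ℕ) * s ^ 2 / (4 * K ^ 2)))) := by
  set q : (Fin (2 * l + 1) → ℂ) → ℝ := fun v => (star v ⬝ᵥ (H *ᵥ v)).re with hq
  -- This t minimises the Chernoff exponent t² K² - t s, and s ≤ K ensures t K ≤ 1/2.
  set t : ℝ := s / (2 * K ^ 2) with ht
  have ht0 : 0 ≤ t := by positivity
  have htK : t * K ≤ 1 / 2 := by
    rw [ht, div_mul_eq_mul_div, div_le_iff₀ (by positivity)]
    nlinarith
  have heig : ∀ i, |hH.eigenvalues i| ≤ K := by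
    intro i
    have h1 := hH.eigenvalues_eq i
    have h2 := hbd (hH.eigenvectorBasis i).ofLp
    have h3 : normSqSum (hH.eigenvectorBasis i).ofLp = 1 := by
      have := EuclideanSpace.norm_sq_eq (hH.eigenvectorBasis i)
      rw [hH.eigenvectorBasis.orthonormal.1 i] at this
      rw [normSqSum, ← this]
      norm_num
    rw [h3, mul_one] at h2
    rw [h1]
    exact h2
  have hteig : ∀ i, |t * hH.eigenvalues i| ≤ 1 / 2 := fun i => by
    rw [abs_mul, abs_of_nonneg ht0]
    exact (mul_le_mul_of_nonneg_left (heig i) ht0).trans htK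
  have hqc : Continuous q := by
    simp only [hq, dotProduct, Matrix.mulVec]
    fun_prop
  have hle := lintegral_exp_column_le (Q := fun v => t * q v) (hqc.const_mul t)
    (fun c v => by
      simp only [hq, Matrix.mulVec_smul, star_smul, smul_dotProduct, dotProduct_smul]
      simp
      ring) m
    (fun v hv => by
      have h1 := hbd v
      rw [hv, mul_one] at h1
      have h2 := mul_le_mul_of_nonneg_left ((le_abs_self _).trans h1) ht0
      exact lt_of_le_of_lt (h2.trans htK) (by norm_num))
  rw [lintegral_gaussian_hermitian hH
    (fun i => lt_of_le_of_lt (le_abs_self _) (lt_of_le_of_lt (hteig i) (by norm_num)))] at hle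
  have hsum : ∑ i, hH.eigenvalues i = 0 := by
    have h1 := hH.trace_eq_sum_eigenvalues
    rw [htr] at h1
    have h2 : ((∑ i, hH.eigenvalues i : ℝ) : ℂ) = 0 := by
      push_cast
      exact h1.symm
    exact_mod_cast h2
  -- The vanishing trace removes the first-order term; only t² K² per eigenvalue remains.
  have hprod : ∏ i, Real.pi / (1 - t * hH.eigenvalues i) ≤
      Real.pi ^ (2 * l + 1) * Real.exp ((2 * l + 1 : ℕ) * (t ^ 2 * K ^ 2)) := by
    calc ∏ i, Real.pi / (1 - t * hH.eigenvalues i)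
        ≤ ∏ i, Real.pi * Real.exp (t * hH.eigenvalues i + t ^ 2 * K ^ 2) := by
          refine Finset.prod_le_prod (fun i _ => ?_) fun i _ => ?_
          · have := (abs_le.1 (hteig i)).2
            exact div_nonneg Real.pi_pos.le (by linarith)
          · rw [div_eq_mul_inv]
            refine mul_le_mul_of_nonneg_left ((inv_one_sub_le_exp (hteig i)).trans ?_)
              Real.pi_pos.le
            refine Real.exp_le_exp.2 (add_le_add_right ?_ _)
            rw [mul_pow]
            refine mul_le_mul_of_nonneg_left ?_ (sq_nonneg t)
            exact sq_le_sq' (abs_le.1 (heig i)).1 (abs_le.1 (heig i)).2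
      _ = Real.pi ^ (2 * l + 1) * Real.exp ((2 * l + 1 : ℕ) * (t ^ 2 * K ^ 2)) := by
          rw [Finset.prod_mul_distrib, ← Real.exp_sum, Finset.sum_add_distrib, ← Finset.mul_sum,
            hsum]
          simp
  set A : Set (UnitaryS2 l) := {U : UnitaryS2 l | s ≤ q (U.1 *ᵥ Pi.single m 1)} with hA
  have hmv := continuous_unitary_mulVec (l := l)
  have hmve : Continuous fun U : UnitaryS2 l => U.1 *ᵥ (Pi.single m 1 : Fin (2 * l + 1) → ℂ) :=
    hmv.comp (Continuous.prodMk continuous_id continuous_const)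
  set F : UnitaryS2 l → ENNReal := fun U => ENNReal.ofReal
    (Real.pi ^ (2 * l + 1) * Real.exp ((2 * l + 1 : ℕ) * (t * q (U.1 *ᵥ Pi.single m 1)))) with hF
  set ε : ℝ := Real.pi ^ (2 * l + 1) * Real.exp ((2 * l + 1 : ℕ) * (t * s)) with hε
  have hεpos : 0 < ε := by positivity
  have hmark : ENNReal.ofReal ε * haarUnitary l A ≤ ∫⁻ U, F U ∂haarUnitary l := by
    have hFm : Measurable F := Measurable.ennreal_ofReal (Continuous.measurable
      (continuous_const.mul (Real.continuous_exp.comp (continuous_const.mul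
        (continuous_const.mul (hqc.comp hmve))))))
    refine le_trans ?_ (mul_meas_ge_le_lintegral hFm (ENNReal.ofReal ε))
    refine mul_le_mul_right (measure_mono fun U hU => ?_) _
    have hU' : s ≤ q (U.1 *ᵥ Pi.single m 1) := hU
    exact ENNReal.ofReal_le_ofReal (mul_le_mul_of_nonneg_left (Real.exp_le_exp.2
      (mul_le_mul_of_nonneg_left (mul_le_mul_of_nonneg_left hU' ht0) (Nat.cast_nonneg _)))
      (by positivity))
  have hfin := hmark.trans (hle.trans (ENNReal.ofReal_le_ofReal hprod))
  have hεne : ENNReal.ofReal ε ≠ 0 := by simpa using hεpos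
  have h1 : haarUnitary l A ≤
      ENNReal.ofReal (Real.pi ^ (2 * l + 1) * Real.exp ((2 * l + 1 : ℕ) * (t ^ 2 * K ^ 2))) / ENNReal.ofReal ε := by
    rw [ENNReal.le_div_iff_mul_le (Or.inl hεne) (Or.inl ENNReal.ofReal_ne_top), mul_comm]
    exact hfin
  refine h1.trans (le_of_eq ?_)
  rw [← ENNReal.ofReal_div_of_pos hεpos, hε, mul_div_mul_left _ _ (by positivity),
    ← Real.exp_sub]
  congr 2
  rw [ht]
  field_simp
  ring

end HaarConcentration

/-! ### Expectations of observables in a random basis element. -/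

section Tail

open scoped Matrix

/-- The quantum expectation `⟨f, β f⟩` of the observable `β` in the state `f`. -/
noncomputable def expectationS2 (β f : C(S2, ℂ)) : ℂ := inner ℂ (toL2 f) (toL2 (β * f))

theorem expectationS2_eq_integral (β f : C(S2, ℂ)) :
    expectationS2 β f = ∫ x, β x * ((‖f x‖ ^ 2 : ℝ) : ℂ) ∂volS2 := by
  rw [expectationS2, inner_toL2]
  refine integral_congr_ae (Filter.Eventually.of_forall fun x => ?_)
  have h := Complex.conj_mul' (f x)
  simp only [ContinuousMap.mul_apply]
  push_cast
  rw [← h]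
  ring

theorem continuous_expectationS2 (β : C(S2, ℂ)) : Continuous (expectationS2 β) :=
  continuous_toL2.inner (continuous_toL2.comp (continuous_const.mul continuous_id))

theorem expectationS2_sum {l : ℕ} (β : C(S2, ℂ)) (e : Fin (2 * l + 1) → C(S2, ℂ))
    (v : Fin (2 * l + 1) → ℂ) :
    expectationS2 β (∑ j, v j • e j) =
      star v ⬝ᵥ ((Matrix.of fun i j => inner ℂ (toL2 (e i)) (toL2 (β * e j))) *ᵥ v) := by
  rw [expectationS2, Finset.mul_sum, map_sum, map_sum, sum_inner]
  simp only [dotProduct, Matrix.mulVec, Matrix.of_apply]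
  refine Finset.sum_congr rfl fun i _ => ?_
  rw [inner_sum, Finset.mul_sum]
  refine Finset.sum_congr rfl fun j _ => ?_
  rw [mul_smul_comm, map_smul, map_smul, inner_smul_left, inner_smul_right]
  simp only [Pi.star_apply, RCLike.star_def]
  ring

theorem IsHarmonicONB.expectationS2_one {l : ℕ} {e : Fin (2 * l + 1) → C(S2, ℂ)}
    (he : IsHarmonicONB l e) (v : Fin (2 * l + 1) → ℂ) :
    expectationS2 1 (∑ j, v j • e j) = (normSqSum v : ℂ) := by
  rw [expectationS2_sum, ← star_dotProduct_self_eq]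
  have : (Matrix.of fun i j => inner ℂ (toL2 (e i)) (toL2 (1 * e j))) = (1 : Matrix _ _ ℂ) := by
    ext i j
    rw [Matrix.of_apply, one_mul, inner_toL2, he.2, Matrix.one_apply]
  rw [this, Matrix.one_mulVec]

theorem norm_expectationS2_le {β : C(S2, ℂ)} {K : ℝ} (hβ : ∀ x, ‖β x‖ ≤ K) (f : C(S2, ℂ)) :
    ‖expectationS2 β f‖ ≤ K * (expectationS2 1 f).re := by
  have h1 : expectationS2 1 f = ((∫ x, ‖f x‖ ^ 2 ∂volS2 : ℝ) : ℂ) := by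
    rw [expectationS2_eq_integral, ← integral_complex_ofReal]
    simp
  have hint : Integrable (fun x => ‖f x‖ ^ 2) volS2 :=
    Continuous.integrable_of_hasCompactSupport (by fun_prop) (HasCompactSupport.of_compactSpace _)
  rw [h1, Complex.ofReal_re, ← integral_const_mul, expectationS2_eq_integral]
  refine (norm_integral_le_integral_norm _).trans
    (integral_mono (integrable_mul_norm_sq β f).norm (hint.const_mul K) fun x => ?_)
  simp only [norm_mul, Complex.norm_real, Real.norm_of_nonneg (sq_nonneg ‖f x‖)]
  exact mul_le_mul_of_nonneg_right (hβ x) (sq_nonneg _)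

/-- Concentration of the expectation of a real centered observable in a random element of the
basis. -/
theorem haarONB_expectation_tail {l : ℕ} (b₀ : HarmonicONB l) {β : C(S2, ℂ)}
    (hreal : ∀ x, starRingEnd ℂ (β x) = β x) (hmean : ⨍ x, β x ∂volS2 = 0) {K : ℝ} (hK : 0 < K)
    (hβ : ∀ x, ‖β x‖ ≤ K) (m : Fin (2 * l + 1)) {s : ℝ} (hs0 : 0 ≤ s) (hsK : s ≤ K) :
    haarONB b₀ {b | s ≤ (expectationS2 β (b.1 m)).re} ≤
      ENNReal.ofReal (Real.exp (-((2 * l + 1 : ℕ) * s ^ 2 / (4 * K ^ 2)))) := by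
  have he := b₀.2
  set H : Matrix (Fin (2 * l + 1)) (Fin (2 * l + 1)) ℂ :=
    Matrix.of fun i j => inner ℂ (toL2 (b₀.1 i)) (toL2 (β * b₀.1 j)) with hHdef
  have hH : H.IsHermitian := by
    ext i j
    simp only [hHdef, Matrix.conjTranspose_apply, Matrix.of_apply]
    rw [inner_toL2, inner_toL2, ← starRingEnd_apply, ← integral_conj]
    refine integral_congr_ae (Filter.Eventually.of_forall fun x => ?_)
    simp only [ContinuousMap.mul_apply, map_mul, hreal, Complex.conj_conj]
    ring
  -- The trace is the sum of the expectations over the basis, which the local Weyl law evaluates.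
  have htr : H.trace = 0 := by
    have h := he.sum_integral_eq β
    rw [hmean, mul_zero] at h
    rw [← h, Matrix.trace]
    exact Finset.sum_congr rfl fun i _ => expectationS2_eq_integral β (b₀.1 i)
  have hbd : ∀ v, |(star v ⬝ᵥ (H *ᵥ v)).re| ≤ K * normSqSum v := by
    intro v
    have h1 := norm_expectationS2_le hβ (∑ j, v j • b₀.1 j)
    rw [he.expectationS2_one, Complex.ofReal_re, expectationS2_sum] at h1
    exact (Complex.abs_re_le_norm _).trans h1
  have hcont : Continuous fun b : HarmonicONB l => (expectationS2 β (b.1 m)).re :=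
    Complex.continuous_re.comp ((continuous_expectationS2 β).comp
      ((continuous_apply m).comp continuous_subtype_val))
  have hclosed : IsClosed {b : HarmonicONB l | s ≤ (expectationS2 β (b.1 m)).re} :=
    isClosed_le continuous_const hcont
  rw [haarONB, Measure.map_apply b₀.continuous_rotate.measurable hclosed.measurableSet]
  refine le_trans (le_of_eq ?_) (haarUnitary_column_tail hH htr hK hbd m hs0 hsK)
  congr 1
  ext U
  -- The m-th member of the rotated basis involves only the m-th column of U.
  have hU : (b₀.rotate U).1 m = ∑ j, (U.1 *ᵥ Pi.single m 1) j • b₀.1 j := by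
    rw [Matrix.mulVec_single_one]
    rfl
  simp only [Set.mem_preimage, Set.mem_ofPred_eq]
  rw [hU, expectationS2_sum]

end Tail

/-! ### Reduction to real centred observables, union bound and constants. -/

theorem measure_le_four_mul_card {Ω ι : Type*} [MeasurableSpace Ω] [Fintype ι] (μ : Measure Ω)
    (B : ι → Fin 4 → Set Ω) {A : Set Ω} {δ : ℝ}
    (hA : A ⊆ ⋃ i, ⋃ k, B i k) (hB : ∀ i k, μ (B i k) ≤ ENNReal.ofReal δ) :
    μ A ≤ ENNReal.ofReal (4 * Fintype.card ι * δ) := by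
  calc μ A ≤ ∑ i, ∑ k, μ (B i k) :=
        (measure_mono hA).trans ((measure_iUnion_fintype_le _ _).trans
          (Finset.sum_le_sum fun i _ => measure_iUnion_fintype_le _ _))
    _ ≤ ∑ _i : ι, ∑ _k : Fin 4, ENNReal.ofReal δ :=
        Finset.sum_le_sum fun i _ => Finset.sum_le_sum fun k _ => hB i k
    _ = ENNReal.ofReal (4 * Fintype.card ι * δ) := by
        simp only [Finset.sum_const, Finset.card_univ, Fintype.card_fin, nsmul_eq_mul]
        rw [ENNReal.ofReal_mul (by positivity), ENNReal.ofReal_mul (by norm_num)]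
        simp
        ring

/-- The four real observables `± Re (a - ⨍ a)`, `± Im (a - ⨍ a)`. -/
noncomputable def centeredParts (a : C(S2, ℂ)) (k : Fin 4) : C(S2, ℂ) :=
  ⟨fun x => (((![1, -1, -Complex.I, Complex.I] k * (a x - ⨍ y, a y ∂volS2)).re : ℝ) : ℂ), by
    fun_prop⟩

theorem norm_average_le (a : C(S2, ℂ)) : ‖⨍ y, a y ∂volS2‖ ≤ ‖a‖ := by
  rw [average_eq, norm_smul]
  have hv : 0 < volS2.real Set.univ := by
    rw [Measure.real, ENNReal.toReal_pos_iff]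
    exact ⟨isOpen_univ.measure_pos _ Set.univ_nonempty, measure_lt_top _ _⟩
  have h := norm_integral_le_of_norm_le_const (μ := volS2) (f := a) (C := ‖a‖)
    (Filter.Eventually.of_forall fun x => a.norm_coe_le_norm x)
  rw [Real.norm_of_nonneg (inv_nonneg.2 hv.le), inv_mul_le_iff₀ hv, mul_comm]
  exact h

theorem norm_centeredParts_le (a : C(S2, ℂ)) (k : Fin 4) (x : S2) :
    ‖centeredParts a k x‖ ≤ 2 * ‖a‖ + 1 := by
  have h1 : ‖a x - ⨍ y, a y ∂volS2‖ ≤ 2 * ‖a‖ := by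
    have := norm_sub_le (a x) (⨍ y, a y ∂volS2)
    have h2 := a.norm_coe_le_norm x
    have h3 := norm_average_le a
    linarith
  have h2 : ‖(![1, -1, -Complex.I, Complex.I] k : ℂ)‖ = 1 := by fin_cases k <;> simp
  have h3 : ‖centeredParts a k x‖ ≤
      ‖![1, -1, -Complex.I, Complex.I] k * (a x - ⨍ y, a y ∂volS2)‖ := by
    rw [centeredParts, ContinuousMap.coe_mk, Complex.norm_real]
    exact Complex.abs_re_le_norm _
  rw [norm_mul, h2, one_mul] at h3
  linarith

theorem average_centeredParts (a : C(S2, ℂ)) (k : Fin 4) :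
    ⨍ x, centeredParts a k x ∂volS2 = 0 := by
  have hne : NeZero volS2 := ⟨fun h => by
    have := isOpen_univ.measure_pos volS2 Set.univ_nonempty
    simp [h] at this⟩
  have hint : Integrable (fun x => a x - ⨍ y, a y ∂volS2) volS2 :=
    (integrable_continuousMap a).sub (integrable_const _)
  have h0 : ∫ x, (a x - ⨍ y, a y ∂volS2) ∂volS2 = 0 := by
    exact integral_sub_average volS2 a
  have h1 : ∫ x, centeredParts a k x ∂volS2 = 0 := by
    have h2 := integral_re (hint.const_mul (![1, -1, -Complex.I, Complex.I] k))
    rw [integral_const_mul, h0] at h2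
    have h3 : ∫ x, centeredParts a k x ∂volS2 = ((∫ x,
        (![1, -1, -Complex.I, Complex.I] k * (a x - ⨍ y, a y ∂volS2)).re ∂volS2 : ℝ) : ℂ) := by
      rw [← integral_complex_ofReal]
      rfl
    rw [h3]
    have h4 : (∫ x, (![1, -1, -Complex.I, Complex.I] k * (a x - ⨍ y, a y ∂volS2)).re ∂volS2) = 0 := by
      simpa using h2
    rw [h4, Complex.ofReal_zero]
  rw [average_eq, h1, smul_zero]

/-- As |f|² has mass one, centring a subtracts exactly its mean from the expectation; as |f|² is
real, real parts pass through the integral. -/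
theorem re_expectationS2_centeredParts (a f : C(S2, ℂ))
    (hf : ∫ x, ((‖f x‖ ^ 2 : ℝ) : ℂ) ∂volS2 = 1) (k : Fin 4) :
    (expectationS2 (centeredParts a k) f).re = (![1, -1, -Complex.I, Complex.I] k *
      ((∫ x, a x * ((‖f x‖ ^ 2 : ℝ) : ℂ) ∂volS2) - ⨍ x, a x ∂volS2)).re := by
  set w : ℂ := ![1, -1, -Complex.I, Complex.I] k with hw
  set A : ℂ := ⨍ x, a x ∂volS2 with hA
  have hint1 := integrable_mul_norm_sq a f
  have hint2 : Integrable (fun x => A * ((‖f x‖ ^ 2 : ℝ) : ℂ)) volS2 :=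
    integrable_mul_norm_sq (ContinuousMap.const _ A) f
  have h1 : (∫ x, a x * ((‖f x‖ ^ 2 : ℝ) : ℂ) ∂volS2) - A =
      ∫ x, (a x - A) * ((‖f x‖ ^ 2 : ℝ) : ℂ) ∂volS2 := by
    simp only [sub_mul]
    rw [integral_sub hint1 hint2, integral_const_mul, hf, mul_one]
  have hint3 : Integrable (fun x => w * ((a x - A) * ((‖f x‖ ^ 2 : ℝ) : ℂ))) volS2 := by
    simp only [sub_mul]
    exact (hint1.sub hint2).const_mul w
  rw [h1, ← integral_const_mul, expectationS2_eq_integral]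
  have h2 := integral_re hint3
  have h3 := integral_re (integrable_mul_norm_sq (centeredParts a k) f)
  refine h3.symm.trans (Eq.trans ?_ h2)
  refine integral_congr_ae (Filter.Eventually.of_forall fun x => ?_)
  have h4 : centeredParts a k x = (((w * (a x - A)).re : ℝ) : ℂ) := rfl
  simp only [h4, ← mul_assoc]
  simp [Complex.mul_re, -Complex.ofReal_pow]

/-- Since |z| ≤ |Re z| + |Im z|, one of ± Re z, ± Im z is at least r/2. -/
theorem exists_half_le_re_of_le_norm {z : ℂ} {r : ℝ} (hz : r ≤ ‖z‖) :
    ∃ k : Fin 4, r / 2 ≤ (![1, -1, -Complex.I, Complex.I] k * z).re := by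
  by_contra! h
  have h0 := h 0
  have h1 := h 1
  have h2 := h 2
  have h3 := h 3
  simp at h0 h1 h2 h3
  have h4 := Complex.norm_le_abs_re_add_abs_im z
  have h5 : |z.re| < r / 2 := abs_lt.2 ⟨by linarith, h0⟩
  have h6 : |z.im| < r / 2 := abs_lt.2 ⟨by linarith, by linarith⟩
  linarith

/-- With c = 1 / (16 K²), the exponent is at least 2 c l^(3/4) ≥ 2 c √l. One half of 2 c √l absorbs
the number 4(2l + 1) of events, the other half is the final rate. -/
theorem four_mul_exp_le {l : ℕ} (hl : 1 ≤ l) {K : ℝ} (hK : 1 ≤ K) :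
    4 * ((2 * l + 1 : ℕ) : ℝ) * Real.exp (-((2 * l + 1 : ℕ) *
        ((l : ℝ) ^ (-(1 / 8) : ℝ) / 2) ^ 2 / (4 * K ^ 2))) ≤
      (16 / (1 / (16 * K ^ 2)) ^ 2 + 4) * Real.exp (-(1 / (16 * K ^ 2) * Real.sqrt l)) := by
  set c : ℝ := 1 / (16 * K ^ 2) with hc
  have hcpos : 0 < c := by positivity
  have hl0 : (0 : ℝ) < l := by exact_mod_cast hl
  have hl1 : (1 : ℝ) ≤ l := by exact_mod_cast hl
  have h1 : ((l : ℝ) ^ (-(1 / 8) : ℝ)) ^ 2 = (l : ℝ) ^ (-(1 / 4) : ℝ) := by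
    rw [← Real.rpow_mul_natCast hl0.le]
    norm_num
  have h2 : Real.sqrt l ≤ l * (l : ℝ) ^ (-(1 / 4) : ℝ) := by
    have : (l : ℝ) * (l : ℝ) ^ (-(1 / 4) : ℝ) = (l : ℝ) ^ (3 / 4 : ℝ) := by
      conv_lhs => rw [← Real.rpow_one_add' hl0.le (by norm_num)]
      norm_num
    rw [this, Real.sqrt_eq_rpow]
    exact Real.rpow_le_rpow_of_exponent_le hl1 (by norm_num)
  have h3 : 2 * c * Real.sqrt l ≤ (2 * l + 1 : ℕ) *
      ((l : ℝ) ^ (-(1 / 8) : ℝ) / 2) ^ 2 / (4 * K ^ 2) := by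
    have hp : 0 ≤ (l : ℝ) ^ (-(1 / 4) : ℝ) := Real.rpow_nonneg hl0.le _
    rw [div_pow, h1]
    push_cast
    have : (2 * (l : ℝ) + 1) * ((l : ℝ) ^ (-(1 / 4) : ℝ) / 2 ^ 2) / (4 * K ^ 2) =
        c * ((2 * l + 1) * (l : ℝ) ^ (-(1 / 4) : ℝ)) := by
      rw [hc]
      field_simp
      norm_num
    rw [this, mul_comm 2 c, mul_assoc]
    refine mul_le_mul_of_nonneg_left ?_ hcpos.le
    linarith
  -- From y²/2 ≤ exp y at y = c √l; eight times this bound gives the constant 16 / c².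
  have h4 : (l : ℝ) ≤ 2 / c ^ 2 * Real.exp (c * Real.sqrt l) := by
    have hy : 0 ≤ c * Real.sqrt l := by positivity
    have h5 := Real.quadratic_le_exp_of_nonneg hy
    have h6 : (c * Real.sqrt l) ^ 2 = c ^ 2 * l := by rw [mul_pow, Real.sq_sqrt hl0.le]
    rw [div_mul_eq_mul_div, le_div_iff₀ (by positivity)]
    nlinarith
  have h7 : (1 : ℝ) ≤ Real.exp (c * Real.sqrt l) := Real.one_le_exp (by positivity)
  calc 4 * ((2 * l + 1 : ℕ) : ℝ) * Real.exp (-((2 * l + 1 : ℕ) *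
        ((l : ℝ) ^ (-(1 / 8) : ℝ) / 2) ^ 2 / (4 * K ^ 2)))
      ≤ 4 * ((2 * l + 1 : ℕ) : ℝ) * Real.exp (-(2 * c * Real.sqrt l)) :=
        mul_le_mul_of_nonneg_left (Real.exp_le_exp.2 (neg_le_neg h3)) (by positivity)
    _ ≤ ((16 / c ^ 2 + 4) * Real.exp (c * Real.sqrt l)) * Real.exp (-(2 * c * Real.sqrt l)) := by
        refine mul_le_mul_of_nonneg_right ?_ (Real.exp_pos _).le
        push_cast
        have : (16 / c ^ 2 + 4) * Real.exp (c * Real.sqrt l) =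
          8 * (2 / c ^ 2 * Real.exp (c * Real.sqrt l)) + 4 * Real.exp (c * Real.sqrt l) := by ring
        rw [this]
        linarith
    _ = _ := by
        rw [mul_assoc, ← Real.exp_add]
        congr 2
        ring

theorem theoremt (a : C(S2, ℂ)) :
    ∃ C : ℝ, 0 < C ∧ ∃ c : ℝ, 0 < c ∧ ∀ l : ℕ,
      Nonempty (HarmonicONB l) ∧
      ∀ b₀ : HarmonicONB l,
        haarONB b₀ {b : HarmonicONB l |
          (l : ℝ) ^ (-(1 / 8) : ℝ) ≤
            ⨆ m : Fin (2 * l + 1),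
              ‖(∫ x, a x * ((‖b.1 m x‖ ^ 2 : ℝ) : ℂ) ∂volS2) - ⨍ x, a x ∂volS2‖}
          ≤ ENNReal.ofReal (C * Real.exp (-(c * Real.sqrt l))) := by
  -- The added 1 guarantees r/2 ≤ K, as the tail bound demands, even when a = 0.
  set K : ℝ := 2 * ‖a‖ + 1 with hKdef
  have hK : 1 ≤ K := by
    have := norm_nonneg a
    linarith
  refine ⟨16 / (1 / (16 * K ^ 2)) ^ 2 + 4, by positivity, 1 / (16 * K ^ 2), by positivity,
    fun l => ⟨inferInstance, fun b₀ => ?_⟩⟩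
  -- For l = 0 the power is 0 by convention and the event is everything; the bound still holds
  -- because C ≥ 4.
  rcases Nat.eq_zero_or_pos l with rfl | hl
  · refine prob_le_one.trans ?_
    rw [← ENNReal.ofReal_one]
    refine ENNReal.ofReal_le_ofReal ?_
    have : 0 ≤ 16 / (1 / (16 * K ^ 2)) ^ 2 := by positivity
    simp only [Nat.cast_zero, Real.sqrt_zero, mul_zero, neg_zero, Real.exp_zero, mul_one]
    linarith
  set r : ℝ := (l : ℝ) ^ (-(1 / 8) : ℝ) with hr
  have hr0 : 0 ≤ r := Real.rpow_nonneg (Nat.cast_nonneg l) _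
  have hr1 : r ≤ 1 := Real.rpow_le_one_of_one_le_of_nonpos (by exact_mod_cast hl) (by norm_num)
  have htail := measure_le_four_mul_card (haarONB b₀)
    (fun (m : Fin (2 * l + 1)) k =>
      {b : HarmonicONB l | r / 2 ≤ (expectationS2 (centeredParts a k) (b.1 m)).re})
    (A := {b : HarmonicONB l | r ≤ ⨆ m : Fin (2 * l + 1),
      ‖(∫ x, a x * ((‖b.1 m x‖ ^ 2 : ℝ) : ℂ) ∂volS2) - ⨍ x, a x ∂volS2‖})
    (δ := Real.exp (-((2 * l + 1 : ℕ) * (r / 2) ^ 2 / (4 * K ^ 2))))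
    (fun b hb => by
      obtain ⟨m, hm⟩ := exists_eq_ciSup_of_finite (f := fun m : Fin (2 * l + 1) =>
        ‖(∫ x, a x * ((‖b.1 m x‖ ^ 2 : ℝ) : ℂ) ∂volS2) - ⨍ x, a x ∂volS2‖)
      have hb' := hb.out
      rw [← hm] at hb'
      obtain ⟨k, hk⟩ := exists_half_le_re_of_le_norm hb'
      refine Set.mem_iUnion.2 ⟨m, Set.mem_iUnion.2 ⟨k, ?_⟩⟩
      rw [Set.mem_ofPred_eq, re_expectationS2_centeredParts a _ (b.2.integral_norm_sq m)]
      exact hk)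
    (fun m k => haarONB_expectation_tail b₀ (fun x => Complex.conj_ofReal _)
      (average_centeredParts a k) (by linarith) (norm_centeredParts_le a k) m (by linarith)
      (by linarith))
  refine htail.trans (ENNReal.ofReal_le_ofReal ?_)
  rw [Fintype.card_fin]
  exact four_mul_exp_le hl hK
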